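/- Let $n\ge 3$ and let $(M,g)$ be a compact smooth Riemannian manifold of dimension $n$ with boundary $\partial M$. Let $S,K:M\to\mathbb R$ and $H:\partial M\to\mathbb R$ be continuous functions with $K<0$ on $M$ (for instance, $S$ may be the scalar curvature of $g$, and $K$, $H$ smooth functions prescribed as scalar curvature and boundary mean curvature). Write $2^*=\frac{2n}{n-2}$, $2^\sharp=\frac{2(n-1)}{n-2}$ and, for $u\in H^1(M)$, $$I(u)=\frac{2(n-1)}{n-2}\int_M|\nabla u|^2+\frac12\int_M S\,u^2-\frac1{2^*}\int_M K\,|u|^{2^*}-(n-2)\int_{\partial M}H\,|u|^{2^\sharp},$$ where the integrals are taken with respect to the Riemannian volume of $M$ and the induced surface measure of $\partial M$, and $u$ is understood in the sense of traces on $\partial M$. For $x\in\partial M$ let $$\mathfrak D_n(x)=\sqrt{n(n-1)}\,\frac{H(x)}{\sqrt{|K(x)|}}.$$ If there exists $p\in\partial M$ such that $\mathfrak D_n(p)>1$, then there is a sequence $(\varphi_k)$ in $H^1(M)$ such that $\varphi_k>0$ on $M$ for every $k$, all the integrals in $I(\varphi_k)$ converge, and $I(\varphi_k)\to-\infty$ as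 $k\to+\infty$. -/

import Mathlib

open MeasureTheory Filter Topology Bundle Manifold
open scoped ContDiff ENNReal

noncomputable section

section Gradient

variable {n : ℕ} [NeZero n] {M : Type*} [TopologicalSpace M]
  [ChartedSpace (EuclideanHalfSpace n) M] [RiemannianBundle (fun x : M ↦ TangentSpace (𝓡∂ n) x)]

instance (x : M) : FiniteDimensional ℝ (TangentSpace (𝓡∂ n) x) :=
  inferInstanceAs (FiniteDimensional ℝ (EuclideanSpace ℝ (Fin n)))

/-- The gradient of a real function on a Riemannian `n`-manifold with boundary: the tangent vector
that represents the differential of the function through the Riemannian metric. -/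
def riemGradient (f : M → ℝ) (x : M) : TangentSpace (𝓡∂ n) x :=
  haveI : CompleteSpace (TangentSpace (𝓡∂ n) x) := FiniteDimensional.complete ℝ _
  (InnerProductSpace.toDual ℝ (TangentSpace (𝓡∂ n) x)).symm (mfderiv (𝓡∂ n) 𝓘(ℝ, ℝ) f x)

theorem inner_riemGradient (f : M → ℝ) (x : M) (v : TangentSpace (𝓡∂ n) x) :
    inner ℝ (riemGradient f x) v = mfderiv (𝓡∂ n) 𝓘(ℝ, ℝ) f x v := by
  unfold riemGradient
  exact InnerProductSpace.toDual_symm_apply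

end Gradient

/-- The Riemannian volume of an `n`-dimensional Riemannian manifold: the `n`-dimensional Hausdorff
measure of the Riemannian distance, normalized so as to be the Lebesgue measure on Euclidean
`n`-space. -/
def riemVolume (n : ℕ) (M : Type*) [EMetricSpace M] [MeasurableSpace M] [BorelSpace M] :
    Measure M :=
  μHE[n]

/-- The surface measure of the boundary of an `n`-dimensional Riemannian manifold: the
`(n - 1)`-dimensional Hausdorff measure, with the Euclidean normalization, of the boundary. -/
def surfaceMeasure (n : ℕ) [NeZero n] (M : Type*) [EMetricSpace M] [MeasurableSpace M]
    [BorelSpace M] [ChartedSpace (EuclideanHalfSpace n) M] :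
    Measure ((𝓡∂ n).boundary M) :=
  μHE[n - 1]

/-- The Sobolev space `H¹(M)` of a compact Riemannian manifold with boundary, the completion of the
smooth functions (smooth up to the boundary) for the norm `‖u‖² + ‖∇u‖²` in `L²`. An element is
stored together with its weak gradient and its boundary trace. Up to null sets both are
determined by the function, being the `L²` limits of the gradients and of the boundary values of
smooth functions that converge in `H¹`. -/
structure SobolevH1 (n : ℕ) [NeZero n] (M : Type*) [EMetricSpace M] [MeasurableSpace M]
    [BorelSpace M] [ChartedSpace (EuclideanHalfSpace n) M]
    [RiemannianBundle (fun x : M ↦ TangentSpace (𝓡∂ n) x)] where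
  /-- the function -/
  toFun : M → ℝ
  /-- its weak gradient -/
  grad : (x : M) → TangentSpace (𝓡∂ n) x
  /-- its boundary trace -/
  trace : (𝓡∂ n).boundary M → ℝ
  aemeasurable_toFun : AEMeasurable toFun (riemVolume n M)
  /-- the gradient is a measurable vector field: its products with the gradients of smooth
  functions, that is, the derivatives of smooth functions along it, are measurable -/
  aemeasurable_grad : ∀ f : M → ℝ, ContMDiff (𝓡∂ n) 𝓘(ℝ, ℝ) ∞ f →
    AEMeasurable (fun x ↦ inner ℝ (riemGradient f x) (grad x)) (riemVolume n M)
  aemeasurable_trace : AEMeasurable trace (surfaceMeasure n M)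
  exists_approx : ∃ f : ℕ → M → ℝ,
    (∀ j, ContMDiff (𝓡∂ n) 𝓘(ℝ, ℝ) ∞ (f j)) ∧
    Tendsto (fun j ↦ ∫⁻ x, ‖f j x - toFun x‖ₑ ^ 2 ∂(riemVolume n M)) atTop (𝓝 0) ∧
    Tendsto (fun j ↦ ∫⁻ x, ‖riemGradient (f j) x - grad x‖ₑ ^ 2 ∂(riemVolume n M))
      atTop (𝓝 0) ∧
    Tendsto (fun j ↦ ∫⁻ y, ‖f j y - trace y‖ₑ ^ 2 ∂(surfaceMeasure n M)) atTop (𝓝 0)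

/-- The critical Sobolev exponent `2n / (n - 2)`. -/
def criticalExponent (n : ℕ) : ℝ := 2 * (n : ℝ) / ((n : ℝ) - 2)

/-- The critical exponent `2(n - 1) / (n - 2)` of the boundary trace. -/
def criticalTraceExponent (n : ℕ) : ℝ := 2 * ((n : ℝ) - 1) / ((n : ℝ) - 2)

/-- The function `√(n(n - 1)) H / √|K|` on the boundary. -/
def scalingInvariant {n : ℕ} [NeZero n] {M : Type*} [TopologicalSpace M]
    [ChartedSpace (EuclideanHalfSpace n) M] (K : M → ℝ) (H : (𝓡∂ n).boundary M → ℝ)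
    (p : (𝓡∂ n).boundary M) : ℝ :=
  √((n : ℝ) * ((n : ℝ) - 1)) * (H p / √|K p|)

section Energy

variable {n : ℕ} [NeZero n] {M : Type*} [EMetricSpace M] [MeasurableSpace M] [BorelSpace M]
  [ChartedSpace (EuclideanHalfSpace n) M] [RiemannianBundle (fun x : M ↦ TangentSpace (𝓡∂ n) x)]

/-- The energy
`2(n-1)/(n-2) ∫_M |∇u|² + 1/2 ∫_M S u² - 1/2* ∫_M K |u|^2* - (n-2) ∫_∂M H |u|^2#`. -/
def energy (S K : M → ℝ) (H : (𝓡∂ n).boundary M → ℝ) (u : SobolevH1 n M) : ℝ :=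
  2 * ((n : ℝ) - 1) / ((n : ℝ) - 2) * ∫ x, ‖u.grad x‖ ^ 2 ∂(riemVolume n M)
    + 1 / 2 * ∫ x, S x * u.toFun x ^ 2 ∂(riemVolume n M)
    - 1 / criticalExponent n *
        ∫ x, K x * |u.toFun x| ^ criticalExponent n ∂(riemVolume n M)
    - ((n : ℝ) - 2) *
        ∫ y, H y * |u.trace y| ^ criticalTraceExponent n ∂(surfaceMeasure n M)

/-- All four integrals in the energy of `u` converge. -/
def EnergyConverges (S K : M → ℝ) (H : (𝓡∂ n).boundary M → ℝ) (u : SobolevH1 n M) : Prop :=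
  Integrable (fun x ↦ ‖u.grad x‖ ^ 2) (riemVolume n M) ∧
  Integrable (fun x ↦ S x * u.toFun x ^ 2) (riemVolume n M) ∧
  Integrable (fun x ↦ K x * |u.toFun x| ^ criticalExponent n) (riemVolume n M) ∧
  Integrable (fun y ↦ H y * |u.trace y| ^ criticalTraceExponent n) (surfaceMeasure n M)

end Energy

end

/-! Concentrate along a whole patch of boundary near `p`, not at a point. Put β = (n-2)/2 and σ =
√(|K(p)|/(n(n-1))), so that the hypothesis reads σ < H(p). In coordinates where M is almost
Euclidean near `p` and t ≥ 0 measures the distance to the boundary, take φ = 1 + χ·(σ(t+ε))^(-β)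
with a fixed cutoff χ and ε → 0. Geometrically, (σ(t+ε))^(-2) times the flat metric is hyperbolic of
curvature -σ², has scalar curvature K(p), and its boundary is a horosphere of mean curvature σ; a
larger H makes the boundary term win.

For the profile z^(-β), z = σ(t+ε), the gradient term and the K term each have density
(n-1)(n-2)σ²/2 · z^(-n). Integrating their sum over t ≥ 0 gives (n-2)σ(σε)^(1-n) per unit of
boundary area. Since β·2(n-1)/(n-2) = n-1, the boundary term is (n-2)H(σε)^(1-n) per unit area. With
v the area of the patch, the energy is about (n-2)v(σ - H(p))(σε)^(1-n), which tends to -∞.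

Every error is either bounded in ε or a factor close to 1. The second kind is collected as powers of
one number `lam` > 1, chosen at the end so that a fixed power of it times σ is still below H(p).
Volume and area are Hausdorff measures, so charts that are `lam`-bi-Lipschitz
(`exists_isNearIsometricChart`) suffice to compare them with Lebesgue measure. The pointwise
estimate is `exists_energyDensity_le`; it is integrated in
`IsNearIsometricChart.exists_integral_energyDensity_le`, and the boundary integral is bounded below
in `IsNearIsometricChart.exists_le_integral_trace`. -/

/-! ### Linear normalization of the metric at a point. -/

section Chart

variable {n : ℕ} [NeZero n] {M : Type*} [EMetricSpace M]
  [ChartedSpace (EuclideanHalfSpace n) M] [IsManifold (𝓡∂ n) ∞ M]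
  [RiemannianBundle (fun x : M ↦ TangentSpace (𝓡∂ n) x)]
  [IsContinuousRiemannianBundle (EuclideanSpace ℝ (Fin n))
    (fun x : M ↦ TangentSpace (𝓡∂ n) x)]

/-- An inner product space of dimension `n` with a nonzero functional has Euclidean coordinates
whose first one is a positive multiple of the functional. -/
theorem exists_linearIsometryEquiv_apply_zero {T : Type*} [NormedAddCommGroup T]
    [InnerProductSpace ℝ T] [FiniteDimensional ℝ T] (hT : Module.finrank ℝ T = n)
    (ℓ : T →L[ℝ] ℝ) (hℓ : ℓ ≠ 0) :
    ∃ (e : T ≃ₗᵢ[ℝ] EuclideanSpace ℝ (Fin n)) (c : ℝ), 0 < c ∧ ∀ v, e v 0 = c * ℓ v := by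
  have : CompleteSpace T := FiniteDimensional.complete ℝ T
  set ν := (InnerProductSpace.toDual ℝ T).symm ℓ with hν
  have hν0 : ν ≠ 0 := by simpa [hν] using hℓ
  have h : Orthonormal ℝ (({0} : Set (Fin n)).domRestrict (fun _ ↦ ‖ν‖⁻¹ • ν)) := by
    constructor
    · intro i
      simp [Set.domRestrict, norm_smul, hν0]
    · intro i j hij
      exact absurd (Subsingleton.elim i j) hij
  obtain ⟨b, hb⟩ := h.exists_orthonormalBasis_extension_of_card_eq (by simpa using hT)
  refine ⟨b.repr, ‖ν‖⁻¹, by positivity, fun v ↦ ?_⟩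
  rw [b.repr_apply_apply, hb 0 rfl, real_inner_smul_left, hν,
    InnerProductSpace.toDual_symm_apply]

/-- Composing the fibre coordinates at `x` with a suitable isometry makes the metric at `x`
Euclidean, and continuity of the metric costs a factor `lam` nearby. The isometry is picked so that
the zeroth coordinate is only rescaled: the half-space and its boundary are preserved. -/
theorem exists_chart_linearization (x : M) {lam : ℝ} (hlam : 1 < lam) :
    ∃ (L : EuclideanSpace ℝ (Fin n) ≃L[ℝ] EuclideanSpace ℝ (Fin n)) (c : ℝ), 0 < c ∧
      (∀ v, L v 0 = c * v 0) ∧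
      (∀ᶠ y in 𝓝 x, ∀ v : TangentSpace (𝓡∂ n) y,
        ‖L ((trivializationAt (EuclideanSpace ℝ (Fin n))
          (fun x : M ↦ TangentSpace (𝓡∂ n) x) x).continuousLinearMapAt ℝ y v)‖ ≤ lam * ‖v‖) ∧
      (∀ᶠ y in 𝓝 x, ∀ w : EuclideanSpace ℝ (Fin n),
        ‖(trivializationAt (EuclideanSpace ℝ (Fin n))
          (fun x : M ↦ TangentSpace (𝓡∂ n) x) x).symmL ℝ y w‖ ≤ lam * ‖L w‖) := by
  set t := trivializationAt (EuclideanSpace ℝ (Fin n)) (fun x : M ↦ TangentSpace (𝓡∂ n) x) x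
  have hx : x ∈ t.baseSet := FiberBundle.mem_baseSet_trivializationAt' x
  let G := t.continuousLinearEquivAt ℝ x hx
  let P : EuclideanSpace ℝ (Fin n) →L[ℝ] ℝ := EuclideanSpace.proj 0
  obtain ⟨e, c, hc, he⟩ := exists_linearIsometryEquiv_apply_zero (n := n)
    (T := TangentSpace (𝓡∂ n) x) (by rw [G.toLinearEquiv.finrank_eq]; simp) (P ∘L (G : _ →L[ℝ] _))
    (by
      intro h0
      have := congr($h0 (G.symm (EuclideanSpace.single 0 1)))
      simp [P] at this)
  have hG (w : EuclideanSpace ℝ (Fin n)) :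
      ‖(G.symm.trans e.toContinuousLinearEquiv) w‖ = ‖t.symmL ℝ x w‖ :=
    by
    rw [← t.symm_continuousLinearEquivAt_eq hx]
    exact e.norm_map _
  refine ⟨G.symm.trans e.toContinuousLinearEquiv, c, hc, fun v ↦ ?_, ?_, ?_⟩
  · simpa [P] using he (G.symm v)
  · filter_upwards [eventually_norm_symmL_trivializationAt_self_comp_lt
      (EuclideanSpace ℝ (Fin n)) (fun x : M ↦ TangentSpace (𝓡∂ n) x) x hlam] with y hy v
    have h1 := (t.symmL ℝ x ∘L t.continuousLinearMapAt ℝ y).le_of_opNorm_le hy.le v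
    exact (hG _).trans_le h1
  · filter_upwards [eventually_norm_symmL_trivializationAt_comp_self_lt
      (EuclideanSpace ℝ (Fin n)) (fun x : M ↦ TangentSpace (𝓡∂ n) x) x hlam] with y hy w
    have h1 := (t.symmL ℝ y ∘L t.continuousLinearMapAt ℝ x).le_of_opNorm_le hy.le (t.symmL ℝ x w)
    have h2 : t.continuousLinearMapAt ℝ x (t.symmL ℝ x w) = w :=
      t.continuousLinearMapAt_symmL hx w
    rw [ContinuousLinearMap.comp_apply, h2] at h1
    rwa [hG]
end Chart

/-! ### Charts that are bi-Lipschitz with constant close to 1. -/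

section Lipschitz

open Set Metric
open scoped NNReal

variable {n : ℕ} [NeZero n] {M : Type*} [EMetricSpace M]
  [ChartedSpace (EuclideanHalfSpace n) M]

/-- The preimage of a Euclidean ball under the extended chart at `x` followed by `L`. -/
def chartBall (x : M) (L : EuclideanSpace ℝ (Fin n) ≃L[ℝ] EuclideanSpace ℝ (Fin n)) (r : ℝ) :
    Set M :=
  (chartAt (EuclideanHalfSpace n) x).source ∩
    (fun y ↦ L (extChartAt (𝓡∂ n) x y)) ⁻¹' ball (L (extChartAt (𝓡∂ n) x x)) r

variable [IsManifold (𝓡∂ n) ∞ M]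
  [RiemannianBundle (fun x : M ↦ TangentSpace (𝓡∂ n) x)]

/-- The extended chart at `x` followed by the linear map `L`, which preserves the half-space, is
`lam`-bi-Lipschitz on the preimage of a ball of radius `r`, has image the trace of this ball on the
half-space, and its differential has norm at most `lam`. -/
structure IsNearIsometricChart (x : M)
    (L : EuclideanSpace ℝ (Fin n) ≃L[ℝ] EuclideanSpace ℝ (Fin n)) (lam : ℝ≥0) (r : ℝ) :
    Prop where
  r_pos : 0 < r
  exists_apply_zero : ∃ c : ℝ, 0 < c ∧ ∀ v, L v 0 = c * v 0
  symm_mem_target : ∀ y ∈ ball (L (extChartAt (𝓡∂ n) x x)) r, 0 ≤ y 0 →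
    L.symm y ∈ (extChartAt (𝓡∂ n) x).target
  norm_map_le : ∀ y ∈ chartBall x L r, ∀ v : TangentSpace (𝓡∂ n) y,
    ‖L ((trivializationAt (EuclideanSpace ℝ (Fin n))
      (fun x : M ↦ TangentSpace (𝓡∂ n) x) x).continuousLinearMapAt ℝ y v)‖ ≤ lam * ‖v‖
  edist_le : ∀ y ∈ chartBall x L r, ∀ z ∈ chartBall x L r,
    edist y z ≤ lam * edist (L (extChartAt (𝓡∂ n) x y)) (L (extChartAt (𝓡∂ n) x z))
  edist_map_le : ∀ y ∈ chartBall x L r, ∀ z ∈ chartBall x L r,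
    edist (L (extChartAt (𝓡∂ n) x y)) (L (extChartAt (𝓡∂ n) x z)) ≤ lam * edist y z

-- All tangent spaces are the same type, but their norms depend on the base point; this moves a norm
-- along an equality of base points.
omit [IsManifold (𝓡∂ n) ∞ M] in
theorem norm_tangentSpace_congr {a b : M} (hab : a = b) (v : EuclideanSpace ℝ (Fin n)) :
    norm (E := TangentSpace (𝓡∂ n) a) v = norm (E := TangentSpace (𝓡∂ n) b) v := by
  subst hab; rfl

variable {x : M} {L : EuclideanSpace ℝ (Fin n) ≃L[ℝ] EuclideanSpace ℝ (Fin n)}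

theorem norm_mfderivWithin_extChartAt_symm_le {lam : ℝ} {s : Set M}
    (hs : ∀ y ∈ s, ∀ w : EuclideanSpace ℝ (Fin n),
        ‖(trivializationAt (EuclideanSpace ℝ (Fin n))
          (fun x : M ↦ TangentSpace (𝓡∂ n) x) x).symmL ℝ y w‖ ≤ lam * ‖L w‖)
    {e : EuclideanSpace ℝ (Fin n)} (he : e ∈ (extChartAt (𝓡∂ n) x).target)
    (hes : (extChartAt (𝓡∂ n) x).symm e ∈ s) (w : EuclideanSpace ℝ (Fin n)) :
    ‖mfderivWithin 𝓘(ℝ, EuclideanSpace ℝ (Fin n)) (𝓡∂ n) (extChartAt (𝓡∂ n) x).symm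
      (range (𝓡∂ n)) e w‖ ≤ lam * ‖L w‖ := by
  obtain ⟨y, hy, rfl⟩ : ∃ y ∈ (extChartAt (𝓡∂ n) x).source, extChartAt (𝓡∂ n) x y = e :=
    ⟨_, (extChartAt (𝓡∂ n) x).map_target he, (extChartAt (𝓡∂ n) x).right_inv he⟩
  have hyy := (extChartAt (𝓡∂ n) x).left_inv hy
  rw [hyy] at hes
  have h := hs y hes w
  rw [TangentBundle.symmL_trivializationAt (by simpa using hy)] at h
  exact (norm_tangentSpace_congr (n := n) hyy _).trans_le h

variable [IsRiemannianManifold (𝓡∂ n) M]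

/-- The straight segment in the chart, pulled back to M, is a competitor for the Riemannian
distance, and its speed is at most `lam` times the Euclidean one. -/
theorem edist_le_of_segment_subset {lam : ℝ≥0} {s : Set M}
    (hs : ∀ y ∈ s, ∀ w : EuclideanSpace ℝ (Fin n),
        ‖(trivializationAt (EuclideanSpace ℝ (Fin n))
          (fun x : M ↦ TangentSpace (𝓡∂ n) x) x).symmL ℝ y w‖ ≤ lam * ‖L w‖)
    {y z : M} (hy : y ∈ (chartAt (EuclideanHalfSpace n) x).source)
    (hz : z ∈ (chartAt (EuclideanHalfSpace n) x).source)
    (hyz : segment ℝ (extChartAt (𝓡∂ n) x y) (extChartAt (𝓡∂ n) x z) ⊆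
      (extChartAt (𝓡∂ n) x).target ∩ (extChartAt (𝓡∂ n) x).symm ⁻¹' s) :
    edist y z ≤ lam * edist (L (extChartAt (𝓡∂ n) x y)) (L (extChartAt (𝓡∂ n) x z)) := by
  let η := ContinuousAffineMap.lineMap (R := ℝ) (extChartAt (𝓡∂ n) x y) (extChartAt (𝓡∂ n) x z)
  set γ := (extChartAt (𝓡∂ n) x).symm ∘ η
  have hη : Icc 0 1 ⊆ ⇑η ⁻¹' ((extChartAt (𝓡∂ n) x).target ∩
      (extChartAt (𝓡∂ n) x).symm ⁻¹' s) := by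
    simpa only [← image_subset_iff, ContinuousAffineMap.coe_lineMap_eq,
      ← segment_eq_image_lineMap, η] using hyz
  rw [preimage_inter, subset_inter_iff] at hη
  have η_smooth : CMDiff[Icc 0 1] 1 η := by
    apply ContMDiff.contMDiffOn
    rw [contMDiff_iff_contDiff]
    exact ContinuousAffineMap.contDiff _
  rw [IsRiemannianManifold.out (I := 𝓡∂ n) y z]
  have : riemannianEDist (𝓡∂ n) y z ≤ pathELength (𝓡∂ n) γ 0 1 := by
    apply riemannianEDist_le_pathELength _ _ _ zero_le_one
    · exact (contMDiffOn_extChartAt_symm x).comp η_smooth hη.1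
    · simp [γ, η, ContinuousAffineMap.coe_lineMap_eq, (extChartAt (𝓡∂ n) x).left_inv (by simpa using hy), -extChartAt]
    · simp [γ, η, ContinuousAffineMap.coe_lineMap_eq, (extChartAt (𝓡∂ n) x).left_inv (by simpa using hz), -extChartAt]
  apply this.trans
  rw [pathELength_eq_lintegral_mfderivWithin_Icc]
  have hconst : ∫⁻ _ in Icc (0 : ℝ) 1,
      (lam : ℝ≥0∞) * ‖L (extChartAt (𝓡∂ n) x z - extChartAt (𝓡∂ n) x y)‖ₑ =
      lam * edist (L (extChartAt (𝓡∂ n) x y)) (L (extChartAt (𝓡∂ n) x z)) := by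
    rw [edist_comm, edist_eq_enorm_sub]
    simp [-extChartAt]
  rw [← hconst]
  apply setLIntegral_mono' measurableSet_Icc (fun t ht ↦ ?_)
  have h1 : mfderivWithin 𝓘(ℝ, ℝ) (𝓡∂ n) γ (Icc 0 1) t =
      (mfderivWithin 𝓘(ℝ, EuclideanSpace ℝ (Fin n)) (𝓡∂ n) (extChartAt (𝓡∂ n) x).symm
        (range (𝓡∂ n)) (η t)) ∘L (mfderivWithin 𝓘(ℝ, ℝ) 𝓘(ℝ, EuclideanSpace ℝ (Fin n)) η (Icc 0 1) t) := by
    apply mfderivWithin_comp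
    · exact mdifferentiableWithinAt_extChartAt_symm (hη.1 ht)
    · exact η_smooth.mdifferentiableOn one_ne_zero t ht
    · exact hη.1.trans (preimage_mono (extChartAt_target_subset_range x))
    · rw [uniqueMDiffWithinAt_iff_uniqueDiffWithinAt]
      exact uniqueDiffOn_Icc zero_lt_one t ht
  have h2 : mfderivWithin 𝓘(ℝ, ℝ) (𝓡∂ n) γ (Icc 0 1) t 1 =
      (mfderivWithin 𝓘(ℝ, EuclideanSpace ℝ (Fin n)) (𝓡∂ n) (extChartAt (𝓡∂ n) x).symm
        (range (𝓡∂ n)) (η t)) (mfderivWithin 𝓘(ℝ, ℝ) 𝓘(ℝ, EuclideanSpace ℝ (Fin n)) η (Icc 0 1) t 1) :=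
    congr($h1 1)
  have h3 : mfderivWithin 𝓘(ℝ, ℝ) 𝓘(ℝ, EuclideanSpace ℝ (Fin n)) η (Icc 0 1) t 1 = extChartAt (𝓡∂ n) x z - extChartAt (𝓡∂ n) x y := by
    rw [mfderivWithin_eq_fderivWithin,
      fderivWithin_eq_fderiv (uniqueDiffOn_Icc zero_lt_one _ ht)
        (ContinuousAffineMap.differentiableAt _)]
    have : (fderiv ℝ η t) 1 = extChartAt (𝓡∂ n) x z - extChartAt (𝓡∂ n) x y := by
      simp [η]
    exact this
  rw [h2, h3]
  have h4 := norm_mfderivWithin_extChartAt_symm_le hs (hη.1 ht) (hη.2 ht)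
    (extChartAt (𝓡∂ n) x z - extChartAt (𝓡∂ n) x y)
  rw [← ofReal_norm, ← ofReal_norm, ← ENNReal.ofReal_coe_nnreal,
    ← ENNReal.ofReal_mul (NNReal.coe_nonneg _)]
  exact ENNReal.ofReal_le_ofReal h4

/-- A path of nearly minimal length from `y` to `z` is too short to leave the ball about `y`, so the
bound on the differential holds all along it and controls the length of its image. -/
theorem edist_map_le_of_edist_lt {lam : ℝ≥0} {s : Set M}
    (hs : ∀ y ∈ s, ∀ v : TangentSpace (𝓡∂ n) y,
      ‖L ((trivializationAt (EuclideanSpace ℝ (Fin n))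
        (fun x : M ↦ TangentSpace (𝓡∂ n) x) x).continuousLinearMapAt ℝ y v)‖ ≤ lam * ‖v‖)
    (hsx : s ⊆ (chartAt (EuclideanHalfSpace n) x).source) {y z : M} {δ : ℝ≥0∞}
    (hyz : edist y z < δ) (hδ : Metric.eball y δ ⊆ s) :
    edist (L (extChartAt (𝓡∂ n) x y)) (L (extChartAt (𝓡∂ n) x z)) ≤ lam * edist y z := by
  -- A minimizing path need not be available, so the bound is proved for each `d` above the distance
  -- and `d` is then lowered to it.
  suffices h : ∀ d, edist y z < d → d ≤ δ →
      edist (L (extChartAt (𝓡∂ n) x y)) (L (extChartAt (𝓡∂ n) x z)) ≤ lam * d by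
    have hlim : Tendsto (fun d ↦ (lam : ℝ≥0∞) * d) (𝓝[>] (edist y z))
        (𝓝 (lam * edist y z)) :=
      (ENNReal.Tendsto.const_mul tendsto_id (Or.inr ENNReal.coe_ne_top)).mono_left
        nhdsWithin_le_nhds
    have hne : (𝓝[>] (edist y z)).NeBot := nhdsGT_neBot_of_exists_gt ⟨δ, hyz⟩
    refine ge_of_tendsto hlim ?_
    filter_upwards [Ioc_mem_nhdsGT hyz] with d hd using h d hd.1 hd.2
  intro d hd hdδ
  rw [IsRiemannianManifold.out (I := 𝓡∂ n) y z] at hd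
  obtain ⟨γ, hγ0, hγ1, γ_smooth, hγ⟩ := exists_lt_of_riemannianEDist_lt hd
  have hγs : ∀ t ∈ Icc (0 : ℝ) 1, γ t ∈ s := by
    intro t ht
    apply hδ
    rw [Metric.mem_eball']
    calc edist y (γ t) = riemannianEDist (𝓡∂ n) y (γ t) := IsRiemannianManifold.out _ _
      _ ≤ pathELength (𝓡∂ n) γ 0 t :=
        riemannianEDist_le_pathELength (γ_smooth.mono (Icc_subset_Icc_right ht.2)) hγ0 rfl ht.1
      _ ≤ pathELength (𝓡∂ n) γ 0 1 := pathELength_mono le_rfl ht.2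
      _ < δ := hγ.trans_le hdδ
  let γ₁ := extChartAt (𝓡∂ n) x ∘ γ
  let γ' : ℝ → EuclideanSpace ℝ (Fin n) := fun t ↦ L (γ₁ t)
  have hC₁ : CMDiff[Icc 0 1] 1 γ₁ :=
    contMDiffOn_extChartAt.comp (I' := 𝓡∂ n) (t := (chartAt (EuclideanHalfSpace n) x).source)
      γ_smooth (fun t ht ↦ hsx (hγs t ht))
  have hD₁ : ContDiffOn ℝ 1 γ₁ (Icc 0 1) := contMDiffOn_iff_contDiffOn.1 hC₁
  have hD : ContDiffOn ℝ 1 γ' (Icc 0 1) := L.contDiff.comp_contDiffOn hD₁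
  have hu := uniqueDiffOn_Icc (zero_lt_one (α := ℝ))
  calc edist (L (extChartAt (𝓡∂ n) x y)) (L (extChartAt (𝓡∂ n) x z))
      = ‖γ' 1 - γ' 0‖ₑ := by
        rw [edist_comm, edist_eq_enorm_sub]; simp only [γ', γ₁, Function.comp_apply, hγ0, hγ1]
    _ ≤ ∫⁻ t in Icc 0 1, ‖derivWithin γ' (Icc 0 1) t‖ₑ :=
        enorm_sub_le_lintegral_derivWithin_Icc_of_contDiffOn_Icc hD zero_le_one
    _ ≤ ∫⁻ t in Icc (0 : ℝ) 1, lam * ‖mfderivWithin 𝓘(ℝ, ℝ) (𝓡∂ n) γ (Icc 0 1) t 1‖ₑ := by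
        apply setLIntegral_mono' measurableSet_Icc (fun t ht ↦ ?_)
        have h1 : mfderivWithin 𝓘(ℝ, ℝ) 𝓘(ℝ, EuclideanSpace ℝ (Fin n)) γ₁ (Icc 0 1) t =
            (mfderiv (𝓡∂ n) 𝓘(ℝ, EuclideanSpace ℝ (Fin n)) (extChartAt (𝓡∂ n) x) (γ t)) ∘L (mfderivWithin 𝓘(ℝ, ℝ) (𝓡∂ n) γ (Icc 0 1) t) := by
          apply mfderiv_comp_mfderivWithin
          · exact mdifferentiableAt_extChartAt (hsx (hγs t ht))
          · exact γ_smooth.mdifferentiableOn one_ne_zero _ ht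
          · rw [uniqueMDiffWithinAt_iff_uniqueDiffWithinAt]
            exact hu _ ht
        have h2 : fderivWithin ℝ γ₁ (Icc 0 1) t 1 =
            (trivializationAt (EuclideanSpace ℝ (Fin n))
              (fun x : M ↦ TangentSpace (𝓡∂ n) x) x).continuousLinearMapAt ℝ (γ t)
              (mfderivWithin 𝓘(ℝ, ℝ) (𝓡∂ n) γ (Icc 0 1) t 1) := by
          rw [TangentBundle.continuousLinearMapAt_trivializationAt (hsx (hγs t ht)),
            ← mfderivWithin_eq_fderivWithin, h1]
          rfl
        have h3 : derivWithin γ' (Icc 0 1) t = L (fderivWithin ℝ γ₁ (Icc 0 1) t 1) := by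
          rw [← fderivWithin_derivWithin]
          have := (L.hasFDerivAt.comp_hasFDerivWithinAt t
            ((hD₁.differentiableOn one_ne_zero) t ht).hasFDerivWithinAt).fderivWithin (hu t ht)
          exact congr($this 1)
        rw [h3, h2, ← ofReal_norm, ← ofReal_norm, ← ENNReal.ofReal_coe_nnreal,
          ← ENNReal.ofReal_mul (NNReal.coe_nonneg _)]
        exact ENNReal.ofReal_le_ofReal (hs _ (hγs t ht) _)
    _ = lam * pathELength (𝓡∂ n) γ 0 1 := by
        rw [lintegral_const_mul' _ _ ENNReal.coe_ne_top,
          pathELength_eq_lintegral_mfderivWithin_Icc]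
    _ ≤ lam * d := by gcongr

theorem exists_isNearIsometricChart [IsContinuousRiemannianBundle (EuclideanSpace ℝ (Fin n))
    (fun x : M ↦ TangentSpace (𝓡∂ n) x)] (x : M) {N : Set M} (hN : N ∈ 𝓝 x) {lam : ℝ≥0}
    (hlam : 1 < lam) :
    ∃ (L : EuclideanSpace ℝ (Fin n) ≃L[ℝ] EuclideanSpace ℝ (Fin n)) (r : ℝ),
      IsNearIsometricChart x L lam r ∧ chartBall x L r ⊆ N := by
  obtain ⟨L, c, hc, hL, h1, h2⟩ := exists_chart_linearization (n := n) x (lam := lam) (mod_cast hlam)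
  set ψ := extChartAt (𝓡∂ n) x with hψ
  obtain ⟨δ, hδ, hs⟩ := EMetric.mem_nhds_iff.1 (h1.and (h2.and
    (chart_source_mem_nhds (EuclideanHalfSpace n) x)))
  -- Two points within ρ of `x` are less than 2ρ apart, and the ball of radius 2ρ about either stays
  -- within 3ρ ≤ δ of `x`.
  obtain ⟨ρ, hρ, hρδ⟩ : ∃ ρ : ℝ≥0∞, 0 < ρ ∧ ρ + ρ + ρ ≤ δ :=
    ⟨δ / 3, ENNReal.div_pos hδ.ne' (by simp), (ENNReal.add_thirds δ).le⟩
  have hnh : ψ.target ∩ ψ.symm ⁻¹' (N ∩ Metric.eball x ρ) ∈ 𝓝[range (𝓡∂ n)] (ψ x) := by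
    refine inter_mem (extChartAt_target_mem_nhdsWithin x) (nhdsWithin_le_nhds ?_)
    exact extChartAt_preimage_mem_nhds (inter_mem hN (Metric.eball_mem_nhds x hρ))
  obtain ⟨r₁, hr₁, hball⟩ := Metric.mem_nhdsWithin_iff.1 hnh
  have hLb : L.symm ⁻¹' ball (ψ x) r₁ ∈ 𝓝 (L (ψ x)) :=
    L.symm.continuous.continuousAt.preimage_mem_nhds (by simpa using ball_mem_nhds _ hr₁)
  obtain ⟨r, hr, hrb⟩ := Metric.mem_nhds_iff.1 hLb
  have hkey : ∀ e, L e ∈ ball (L (ψ x)) r → e ∈ range (𝓡∂ n) →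
      e ∈ ψ.target ∩ ψ.symm ⁻¹' (N ∩ Metric.eball x ρ) := fun e he he' ↦
    hball ⟨by simpa using hrb he, he'⟩
  have hV : chartBall x L r ⊆ N ∩ Metric.eball x ρ := by
    rintro y ⟨hy, hy'⟩
    have := (hkey (ψ y) hy' (by rw [hψ, extChartAt_coe]; exact mem_range_self _)).2
    rwa [mem_preimage, ψ.left_inv (by simpa [hψ] using hy)] at this
  have hsub : Metric.eball x ρ ⊆ Metric.eball x δ :=
    Metric.eball_subset_eball ((le_add_self).trans hρδ)
  refine ⟨L, r, ⟨hr, ⟨c, hc, hL⟩, ?_, ?_, ?_, ?_⟩, hV.trans inter_subset_left⟩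
  · intro y hy hy0
    refine (hkey (L.symm y) (by rwa [L.apply_symm_apply]) ?_).1
    rw [range_modelWithCornersEuclideanHalfSpace]
    have := hL (L.symm y)
    rw [L.apply_symm_apply] at this
    rw [this] at hy0
    exact nonneg_of_mul_nonneg_right hy0 hc
  · exact fun y hy ↦ (hs (hsub (hV hy).2)).1
  · intro y hy z hz
    refine edist_le_of_segment_subset (s := Metric.eball x δ) (fun y hy ↦ (hs hy).2.1) hy.1 hz.1 ?_
    -- Both the ball and the half-space are convex, so segments between chart points remain in the
    -- chart, even at the boundary.
    have hconv : Convex ℝ (L ⁻¹' ball (L (ψ x)) r ∩ range (𝓡∂ n)) :=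
      ((convex_ball _ _).linear_preimage L.toLinearEquiv.toLinearMap).inter
        (𝓡∂ n).convex_range
    refine (hconv.segment_subset (x := ψ y) (y := ψ z) ⟨hy.2, mem_range_self _⟩
      ⟨hz.2, mem_range_self _⟩).trans ?_
    intro e he
    exact ⟨(hkey e he.1 he.2).1, hsub (hkey e he.1 he.2).2.2⟩
  · intro y hy z hz
    have hyρ := (hV hy).2
    have hzρ := (hV hz).2
    rw [Metric.mem_eball] at hyρ hzρ
    refine edist_map_le_of_edist_lt (s := Metric.eball x δ) (δ := ρ + ρ) (fun y hy ↦ (hs hy).1)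
      (fun y hy ↦ (hs hy).2.2) ?_ ?_
    · calc edist y z ≤ edist y x + edist z x := edist_triangle_right _ _ _
        _ < ρ + ρ := ENNReal.add_lt_add hyρ hzρ
    · intro w hw
      rw [Metric.mem_eball] at hw ⊢
      calc edist w x ≤ edist w y + edist y x := edist_triangle _ _ _
        _ < ρ + ρ + ρ := ENNReal.add_lt_add hw hyρ
        _ ≤ δ := hρδ

end Lipschitz

/-! ### Hausdorff measure under maps with a Lipschitz inverse. -/

section HausdorffMeasure

open scoped NNReal

variable {X Y : Type*} [EMetricSpace X] [MeasurableSpace X] [BorelSpace X]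
  [EMetricSpace Y] [MeasurableSpace Y] [BorelSpace Y] {f : X → Y} {s : Set X} {K : ℝ≥0}

theorem LipschitzOnWith.euclideanHausdorffMeasure_image_le (hf : LipschitzOnWith K f s) (d : ℕ) :
    μHE[d] (f '' s) ≤ (K : ℝ≥0∞) ^ d * μHE[d] s := by
  simp_rw [Measure.euclideanHausdorffMeasure_def, Measure.smul_apply]
  rw [mul_smul_comm]
  gcongr
  simpa using hf.hausdorffMeasure_image_le (d := (d : ℝ)) (by positivity)

/-- The hypothesis makes `f` injective on `s` with a `K`-Lipschitz inverse; apply the image bound to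
that inverse. -/
theorem euclideanHausdorffMeasure_le_of_edist_le
    (hf : ∀ x ∈ s, ∀ y ∈ s, edist x y ≤ K * edist (f x) (f y)) (d : ℕ) :
    μHE[d] s ≤ (K : ℝ≥0∞) ^ d * μHE[d] (f '' s) := by
  rcases s.eq_empty_or_nonempty with rfl | hs
  · simp
  have : Nonempty X := hs.to_type
  have hinj : Set.InjOn f s := fun x hx y hy hxy ↦ by
    simpa [hxy] using hf x hx y hy
  have hinv := hinj.leftInvOn_invFunOn
  have hL : LipschitzOnWith K (Function.invFunOn f s) (f '' s) := by
    rintro _ ⟨x, hx, rfl⟩ _ ⟨y, hy, rfl⟩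
    rw [hinv hx, hinv hy]
    exact hf x hx y hy
  have h := hL.euclideanHausdorffMeasure_image_le d
  rwa [hinv.image_image] at h

/-- The push-forward of the measure on `s` is dominated by `K ^ d` times the measure on `t`. This
takes the place of a change of variables formula. -/
theorem setLIntegral_comp_le_of_edist_le
    (hf : ∀ x ∈ s, ∀ y ∈ s, edist x y ≤ K * edist (f x) (f y)) (d : ℕ)
    (hs : MeasurableSet s) {t : Set Y}     (hst : Set.MapsTo f s t)
    (hfm : AEMeasurable f ((μHE[d] : Measure X).restrict s)) {F : Y → ℝ≥0∞} (hF : Measurable F) :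
    ∫⁻ x in s, F (f x) ∂μHE[d] ≤ (K : ℝ≥0∞) ^ d * ∫⁻ y in t, F y ∂μHE[d] := by
  rw [← lintegral_map' hF.aemeasurable hfm, ← smul_eq_mul, ← lintegral_smul_measure]
  refine lintegral_mono' (Measure.le_iff.2 fun A hA ↦ ?_) le_rfl
  rw [Measure.map_apply_of_aemeasurable hfm hA, Measure.smul_apply, Measure.restrict_apply hA,
    Measure.restrict_apply' hs]
  refine (euclideanHausdorffMeasure_le_of_edist_le
    (fun x hx y hy ↦ hf x hx.2 y hy.2) d).trans ?_
  rw [smul_eq_mul]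
  gcongr
  rintro _ ⟨x, hx, rfl⟩
  exact ⟨hx.1, hst hx.2⟩

end HausdorffMeasure

/-! ### Splitting off the normal coordinate; the one-dimensional integral. -/

section HalfBall

variable {m : ℕ}

/-- The last `m` coordinates of a point of `ℝ^(m + 1)`. -/
def euclideanTail (y : EuclideanSpace ℝ (Fin (m + 1))) : EuclideanSpace ℝ (Fin m) :=
  WithLp.toLp 2 (fun i ↦ y i.succ)

theorem euclideanTail_sub (y z : EuclideanSpace ℝ (Fin (m + 1))) :
    euclideanTail (y - z) = euclideanTail y - euclideanTail z := rfl

theorem norm_sq_eq_add_norm_euclideanTail_sq (y : EuclideanSpace ℝ (Fin (m + 1))) :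
    ‖y‖ ^ 2 = y 0 ^ 2 + ‖euclideanTail y‖ ^ 2 := by
  simp [EuclideanSpace.norm_sq_eq, Fin.sum_univ_succ, euclideanTail]

theorem norm_euclideanTail_le (y : EuclideanSpace ℝ (Fin (m + 1))) : ‖euclideanTail y‖ ≤ ‖y‖ := by
  rw [← sq_le_sq₀ (norm_nonneg _) (norm_nonneg _), norm_sq_eq_add_norm_euclideanTail_sq y]
  nlinarith [sq_nonneg (y 0)]

theorem norm_eq_norm_euclideanTail {y : EuclideanSpace ℝ (Fin (m + 1))} (hy : y 0 = 0) :
    ‖y‖ = ‖euclideanTail y‖ := by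
  rw [← sq_eq_sq₀ (norm_nonneg _) (norm_nonneg _), norm_sq_eq_add_norm_euclideanTail_sq y, hy]
  ring

theorem dist_eq_dist_euclideanTail {y z : EuclideanSpace ℝ (Fin (m + 1))} (hyz : y 0 = z 0) :
    dist y z = dist (euclideanTail y) (euclideanTail z) := by
  rw [dist_eq_norm, dist_eq_norm, ← euclideanTail_sub]
  exact norm_eq_norm_euclideanTail (by simp [hyz])

theorem measurePreserving_zero_euclideanTail :
    MeasurePreserving (fun y : EuclideanSpace ℝ (Fin (m + 1)) ↦ (y 0, euclideanTail y)) := by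
  have h1 := PiLp.volume_preserving_ofLp (Fin (m + 1))
  have h2 := volume_preserving_piFinSuccAbove (fun _ : Fin (m + 1) ↦ ℝ) 0
  have h3 := (MeasurePreserving.id (volume : Measure ℝ)).prod (PiLp.volume_preserving_toLp (Fin m))
  exact h3.comp (h2.comp h1)

/-- The half-ball lies in the product of a half-line and a ball of one dimension less; conclude by
Tonelli. -/
theorem setLIntegral_halfBall_comp_zero_le {q : EuclideanSpace ℝ (Fin (m + 1))} (r : ℝ)
    {g : ℝ → ℝ≥0∞} (hg : Measurable g) :
    ∫⁻ y in Metric.ball q r ∩ {y | 0 ≤ y 0}, g (y 0) ≤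
      volume (Metric.ball (euclideanTail q) r) * ∫⁻ s in Set.Ici 0, g s := by
  have hsub : Metric.ball q r ∩ {y | 0 ≤ y 0} ⊆
      (fun y : EuclideanSpace ℝ (Fin (m + 1)) ↦ (y 0, euclideanTail y)) ⁻¹'
        (Set.Ici 0 ×ˢ Metric.ball (euclideanTail q) r) := by
    rintro y ⟨hy, hy0⟩
    refine ⟨hy0, ?_⟩
    rw [Metric.mem_ball, dist_eq_norm] at hy ⊢
    exact (norm_euclideanTail_le (y - q)).trans_lt hy
  refine (lintegral_mono_set hsub).trans_eq ?_
  rw [measurePreserving_zero_euclideanTail.setLIntegral_comp_preimage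
    (f := fun z : ℝ × EuclideanSpace ℝ (Fin m) ↦ g z.1)
    (measurableSet_Ici.prod Metric.isOpen_ball.measurableSet) (hg.comp measurable_fst),
    Measure.volume_eq_prod, ← Measure.prod_restrict]
  refine (lintegral_prod (fun z : ℝ × EuclideanSpace ℝ (Fin m) ↦ g z.1)
    (hg.comp measurable_fst).aemeasurable).trans ?_
  simp only [lintegral_const, Measure.restrict_apply_univ]
  rw [lintegral_mul_const _ hg, mul_comm]

theorem lintegral_Ici_rpow_neg {σ ε ν : ℝ} (hσ : 0 < σ) (hε : 0 < ε) (hν : 1 < ν) :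
    ∫⁻ s in Set.Ici (0 : ℝ), ENNReal.ofReal ((σ * (s + ε)) ^ (-ν)) =
      ENNReal.ofReal ((σ * ε) ^ (1 - ν) / (σ * (ν - 1))) := by
  have hpos : ∀ s ∈ Set.Ici (0 : ℝ), 0 < σ * (s + ε) := fun s hs ↦ by
    have : (0 : ℝ) ≤ s := hs
    positivity
  have hder : ∀ s ∈ Set.Ici (0 : ℝ),
      HasDerivAt (fun s ↦ -((σ * (s + ε)) ^ (1 - ν) / (σ * (ν - 1)))) ((σ * (s + ε)) ^ (-ν)) s := by
    intro s hs
    have h1 : HasDerivAt (fun s ↦ σ * (s + ε)) σ s := by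
      simpa using ((hasDerivAt_id s).add_const ε).const_mul σ
    have h2 := ((h1.rpow_const (p := 1 - ν) (Or.inl (hpos s hs).ne')).div_const (σ * (ν - 1))).neg
    refine h2.congr_deriv ?_
    have : ν - 1 ≠ 0 := by linarith
    rw [show 1 - ν - 1 = -ν by ring]
    field_simp
    ring
  have hlim : Tendsto (fun s ↦ -((σ * (s + ε)) ^ (1 - ν) / (σ * (ν - 1)))) atTop (𝓝 0) := by
    have h1 : Tendsto (fun s ↦ σ * (s + ε)) atTop atTop :=
      (tendsto_atTop_add_const_right _ ε tendsto_id).const_mul_atTop hσ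
    have h2 := (tendsto_rpow_neg_atTop (y := ν - 1) (by linarith)).comp h1
    have h3 := (h2.div_const (σ * (ν - 1))).neg
    simpa [Function.comp_def] using h3
  have hnn : ∀ s ∈ Set.Ioi (0 : ℝ), 0 ≤ (σ * (s + ε)) ^ (-ν) := fun s hs ↦
    Real.rpow_nonneg (hpos s (Set.mem_Ici_of_Ioi hs)).le _
  rw [setLIntegral_congr Ioi_ae_eq_Ici.symm,
    ← ofReal_integral_eq_lintegral_ofReal
      (integrableOn_Ioi_deriv_of_nonneg' hder hnn hlim)
      ((ae_restrict_iff' measurableSet_Ioi).2 (ae_of_all _ hnn)),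
    integral_Ioi_of_hasDerivAt_of_nonneg' hder hnn hlim]
  simp

end HalfBall

/-! ### Continuity of gradients, for measurability and integrability. -/

section GradientContinuity

theorem norm_le_of_forall_inner_le {T : Type*} [NormedAddCommGroup T] [InnerProductSpace ℝ T]
    {g : T} {C : ℝ} (hC : 0 ≤ C) (h : ∀ v, inner ℝ g v ≤ C * ‖v‖) : ‖g‖ ≤ C := by
  rcases eq_or_ne ‖g‖ 0 with h0 | h0
  · rwa [h0]
  have h1 := h g
  rw [real_inner_self_eq_norm_sq, sq] at h1
  exact le_of_mul_le_mul_right h1 (lt_of_le_of_ne (norm_nonneg _) h0.symm)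

variable {n : ℕ} [NeZero n] {M : Type*} [TopologicalSpace M]
  [ChartedSpace (EuclideanHalfSpace n) M]
  [RiemannianBundle (fun x : M ↦ TangentSpace (𝓡∂ n) x)] [IsManifold (𝓡∂ n) ∞ M]

theorem exists_continuousAt_inner_riemGradient {f : M → ℝ}
    (hf : ContMDiff (𝓡∂ n) 𝓘(ℝ, ℝ) ∞ f) (x : M) :
    ∃ D : M → EuclideanSpace ℝ (Fin n) →L[ℝ] ℝ, ContinuousAt D x ∧
      ∀ y w, D y w = inner ℝ (riemGradient f y) ((trivializationAt (EuclideanSpace ℝ (Fin n))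
          (fun x : M ↦ TangentSpace (𝓡∂ n) x) x).symmL ℝ y w) := by
  have h := (hf.contMDiffAt (x := x)).mfderiv_const (m := 0) (by simp)
  refine ⟨_, h.continuousAt, fun y w ↦ ?_⟩
  rw [inner_riemGradient]
  simp only [inTangentCoordinates, ContinuousLinearMap.inCoordinates,
    TangentBundle.continuousLinearMapAt_model_space]
  rfl

variable [IsContinuousRiemannianBundle (EuclideanSpace ℝ (Fin n))
    (fun x : M ↦ TangentSpace (𝓡∂ n) x)]

/-- By duality the norm depends on the differential and on the metric. In a trivialization, the
change of metric costs a factor 1 + η and the change of differential an additive ηC, in both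
directions; then η → 0. -/
theorem continuous_norm_riemGradient {f : M → ℝ} (hf : ContMDiff (𝓡∂ n) 𝓘(ℝ, ℝ) ∞ f) :
    Continuous (fun x ↦ ‖riemGradient (n := n) f x‖) := by
  rw [continuous_iff_continuousAt]
  intro x
  set t := trivializationAt (EuclideanSpace ℝ (Fin n)) (fun x : M ↦ TangentSpace (𝓡∂ n) x) x
  have hx : x ∈ t.baseSet := FiberBundle.mem_baseSet_trivializationAt' x
  obtain ⟨D, hD, hDf⟩ := exists_continuousAt_inner_riemGradient hf x
  obtain ⟨C, hC, hCy⟩ := eventually_norm_trivializationAt_lt (EuclideanSpace ℝ (Fin n))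
    (fun x : M ↦ TangentSpace (𝓡∂ n) x) x
  set N := ‖riemGradient (n := n) f x‖ with hN
  have key : ∀ η : ℝ, 0 < η → ∀ᶠ y in 𝓝 x,
      ‖riemGradient (n := n) f y‖ ≤ (1 + η) * N + η * C ∧ N ≤ (1 + η) * ‖riemGradient (n := n) f y‖ + η * C := by
    intro η hη
    have hη1 : 1 < 1 + η := by linarith
    have hDη : ∀ᶠ y in 𝓝 x, ‖D y - D x‖ < η := by
      have := Metric.continuousAt_iff'.1 hD η hη
      simpa only [dist_eq_norm] using this
    filter_upwards [hDη, hCy, t.open_baseSet.mem_nhds hx,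
      eventually_norm_symmL_trivializationAt_self_comp_lt (EuclideanSpace ℝ (Fin n))
        (fun x : M ↦ TangentSpace (𝓡∂ n) x) x hη1,
      eventually_norm_symmL_trivializationAt_comp_self_lt (EuclideanSpace ℝ (Fin n))
        (fun x : M ↦ TangentSpace (𝓡∂ n) x) x hη1] with y hDy hCy' hy h1 h2
    have hCx := hCy.self_of_nhds
    constructor
    · refine norm_le_of_forall_inner_le (by positivity) fun v ↦ ?_
      have e1 : inner ℝ (riemGradient f y) v = D y (t.continuousLinearMapAt ℝ y v) := by
        rw [hDf, t.symmL_continuousLinearMapAt hy]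
      have e2 : D y (t.continuousLinearMapAt ℝ y v) =
          (D y - D x) (t.continuousLinearMapAt ℝ y v) +
          inner ℝ (riemGradient f x) (t.symmL ℝ x (t.continuousLinearMapAt ℝ y v)) := by
        rw [← hDf]; simp
      rw [e1, e2]
      have e3 := (t.symmL ℝ x ∘L t.continuousLinearMapAt ℝ y).le_of_opNorm_le h1.le v
      have e4 := (t.continuousLinearMapAt ℝ y).le_of_opNorm_le hCy'.le v
      have e5 := (le_abs_self _).trans ((D y - D x).le_of_opNorm_le hDy.le
        (t.continuousLinearMapAt ℝ y v))
      have e6 := real_inner_le_norm (riemGradient f x)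
        (t.symmL ℝ x (t.continuousLinearMapAt ℝ y v))
      rw [ContinuousLinearMap.comp_apply] at e3
      calc _ ≤ η * (C * ‖v‖) + N * ((1 + η) * ‖v‖) := by
            refine add_le_add (e5.trans (by gcongr)) (e6.trans (by gcongr))
        _ = _ := by ring
    · refine norm_le_of_forall_inner_le (by positivity) fun v ↦ ?_
      have e1 : inner ℝ (riemGradient f x) v = D x (t.continuousLinearMapAt ℝ x v) := by
        rw [hDf, t.symmL_continuousLinearMapAt hx]
      have e2 : D x (t.continuousLinearMapAt ℝ x v) =
          (D x - D y) (t.continuousLinearMapAt ℝ x v) +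
          inner ℝ (riemGradient f y) (t.symmL ℝ y (t.continuousLinearMapAt ℝ x v)) := by
        rw [← hDf]; simp
      rw [e1, e2]
      have e3 := (t.symmL ℝ y ∘L t.continuousLinearMapAt ℝ x).le_of_opNorm_le h2.le v
      have e4 := (t.continuousLinearMapAt ℝ x).le_of_opNorm_le hCx.le v
      rw [norm_sub_rev] at hDy
      have e5 := (le_abs_self _).trans ((D x - D y).le_of_opNorm_le hDy.le
        (t.continuousLinearMapAt ℝ x v))
      have e6 := real_inner_le_norm (riemGradient f y)
        (t.symmL ℝ y (t.continuousLinearMapAt ℝ x v))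
      rw [ContinuousLinearMap.comp_apply] at e3
      calc _ ≤ η * (C * ‖v‖) + ‖riemGradient f y‖ * ((1 + η) * ‖v‖) := by
            refine add_le_add (e5.trans (by gcongr)) (e6.trans (by gcongr))
        _ = _ := by ring
  refine tendsto_order.2 ⟨fun a ha ↦ ?_, fun b hb ↦ ?_⟩
  · have hlim : Tendsto (fun η : ℝ ↦ (1 + η) * a + η * C) (𝓝[>] 0) (𝓝 ((1 + 0) * a + 0 * C)) :=
      Tendsto.mono_left (Continuous.tendsto (by fun_prop) 0) nhdsWithin_le_nhds
    obtain ⟨η, hη, hη0⟩ := ((hlim.eventually_lt_const (u := N) (by simpa using ha)).and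
      self_mem_nhdsWithin).exists
    have hη0' : 0 < η := hη0
    filter_upwards [key η hη0'] with y hy
    by_contra! hcon
    nlinarith [hy.2]
  · have hlim : Tendsto (fun η : ℝ ↦ (1 + η) * N + η * C) (𝓝[>] 0) (𝓝 ((1 + 0) * N + 0 * C)) :=
      Tendsto.mono_left (Continuous.tendsto (by fun_prop) 0) nhdsWithin_le_nhds
    obtain ⟨η, hη, hη0⟩ := ((hlim.eventually_lt_const (u := b) (by simpa using hb)).and
      self_mem_nhdsWithin).exists
    filter_upwards [key η hη0] with y hy using hy.1.trans_lt hη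

omit [IsManifold (𝓡∂ n) ∞ M] [IsContinuousRiemannianBundle (EuclideanSpace ℝ (Fin n))
    (fun x : M ↦ TangentSpace (𝓡∂ n) x)] in
theorem riemGradient_add {f g : M → ℝ} {x : M} (hf : MDifferentiableAt (𝓡∂ n) 𝓘(ℝ, ℝ) f x)
    (hg : MDifferentiableAt (𝓡∂ n) 𝓘(ℝ, ℝ) g x) :
    riemGradient (n := n) (f + g) x = riemGradient f x + riemGradient g x := by
  refine ext_inner_right ℝ fun v ↦ ?_
  rw [inner_add_left, inner_riemGradient, inner_riemGradient, inner_riemGradient,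
    mfderiv_add hf hg]
  rfl

/-- Polarization reduces this to continuity of norms of gradients. -/
theorem continuous_inner_riemGradient {f g : M → ℝ} (hf : ContMDiff (𝓡∂ n) 𝓘(ℝ, ℝ) ∞ f)
    (hg : ContMDiff (𝓡∂ n) 𝓘(ℝ, ℝ) ∞ g) :
    Continuous (fun x ↦ inner ℝ (riemGradient (n := n) f x) (riemGradient g x)) := by
  have h : ∀ x, inner ℝ (riemGradient (n := n) f x) (riemGradient g x) =
      (‖riemGradient (n := n) (f + g) x‖ ^ 2 - ‖riemGradient (n := n) f x‖ ^ 2 - ‖riemGradient (n := n) g x‖ ^ 2) / 2 := by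
    intro x
    rw [riemGradient_add (hf.mdifferentiable (by simp) x) (hg.mdifferentiable (by simp) x),
      norm_add_sq_real]
    ring
  simp_rw [h]
  exact ((((continuous_norm_riemGradient (hf.add hg)).pow 2).sub
    ((continuous_norm_riemGradient hf).pow 2)).sub
    ((continuous_norm_riemGradient hg).pow 2)).div_const 2

end GradientContinuity

/-! ### Smooth functions in the Sobolev space. -/

section SmoothSobolev

variable {n : ℕ} [NeZero n] {M : Type*} [EMetricSpace M] [MeasurableSpace M] [BorelSpace M]
  [ChartedSpace (EuclideanHalfSpace n) M] [IsManifold (𝓡∂ n) ∞ M]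
  [RiemannianBundle (fun x : M ↦ TangentSpace (𝓡∂ n) x)]
  [IsContinuousRiemannianBundle (EuclideanSpace ℝ (Fin n)) (fun x : M ↦ TangentSpace (𝓡∂ n) x)]

/-- A smooth function as an element of the Sobolev space. -/
noncomputable def SobolevH1.ofSmooth (f : M → ℝ) (hf : ContMDiff (𝓡∂ n) 𝓘(ℝ, ℝ) ∞ f) :
    SobolevH1 n M where
  toFun := f
  grad := riemGradient f
  trace y := f y
  aemeasurable_toFun := hf.continuous.aemeasurable
  aemeasurable_grad g hg := (continuous_inner_riemGradient hg hf).aemeasurable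
  aemeasurable_trace := (hf.continuous.comp continuous_subtype_val).aemeasurable
  exists_approx := ⟨fun _ ↦ f, fun _ ↦ hf, by simp, by simp, by simp⟩

end SmoothSobolev

/-! ### Volume and boundary points in a near-isometric chart. -/

section ChartVolume

open Set Metric
open scoped NNReal

variable {n : ℕ} [NeZero n] {M : Type*} [EMetricSpace M]
  [ChartedSpace (EuclideanHalfSpace n) M]

theorem isOpen_chartBall (x : M) (L : EuclideanSpace ℝ (Fin n) ≃L[ℝ] EuclideanSpace ℝ (Fin n))
    (r : ℝ) : IsOpen (chartBall x L r) := by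
  have h : ContinuousOn (fun y ↦ L (extChartAt (𝓡∂ n) x y))
      (chartAt (EuclideanHalfSpace n) x).source :=
    L.continuous.comp_continuousOn (by simpa using continuousOn_extChartAt (I := 𝓡∂ n) x)
  exact h.isOpen_inter_preimage (chartAt _ x).open_source isOpen_ball

theorem continuousOn_chartBall (x : M)
    (L : EuclideanSpace ℝ (Fin n) ≃L[ℝ] EuclideanSpace ℝ (Fin n)) (r : ℝ) :
    ContinuousOn (fun y ↦ L (extChartAt (𝓡∂ n) x y)) (chartBall x L r) :=
  L.continuous.comp_continuousOn ((continuousOn_extChartAt (I := 𝓡∂ n) x).mono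
    (by rw [extChartAt_source]; exact inter_subset_left))

theorem mem_chartBall_self (x : M)
    (L : EuclideanSpace ℝ (Fin n) ≃L[ℝ] EuclideanSpace ℝ (Fin n)) {r : ℝ} (hr : 0 < r) :
    x ∈ chartBall x L r :=
  ⟨mem_chart_source _ x, mem_ball_self hr⟩

theorem chartBall_mono (x : M)
    (L : EuclideanSpace ℝ (Fin n) ≃L[ℝ] EuclideanSpace ℝ (Fin n)) {r s : ℝ} (hrs : r ≤ s) :
    chartBall x L r ⊆ chartBall x L s :=
  inter_subset_inter_right _ (preimage_mono (ball_subset_ball hrs))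

variable [RiemannianBundle (fun x : M ↦ TangentSpace (𝓡∂ n) x)] [IsManifold (𝓡∂ n) ∞ M]

namespace IsNearIsometricChart

variable {x : M} {L : EuclideanSpace ℝ (Fin n) ≃L[ℝ] EuclideanSpace ℝ (Fin n)} {lam : ℝ≥0}
  {r : ℝ}

theorem apply_zero_nonneg (h : IsNearIsometricChart x L lam r) (y : M) :
    0 ≤ L (extChartAt (𝓡∂ n) x y) 0 := by
  obtain ⟨c, hc, hL⟩ := h.exists_apply_zero
  rw [hL]
  have : extChartAt (𝓡∂ n) x y ∈ range (𝓡∂ n) := mem_range_self _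
  rw [range_modelWithCornersEuclideanHalfSpace] at this
  exact mul_nonneg hc.le this

theorem exists_mem_chartBall (h : IsNearIsometricChart x L lam r) {s : ℝ} (hs : s ≤ r)
    {y : EuclideanSpace ℝ (Fin n)} (hy : y ∈ ball (L (extChartAt (𝓡∂ n) x x)) s)
    (hy0 : 0 ≤ y 0) : ∃ z ∈ chartBall x L s, L (extChartAt (𝓡∂ n) x z) = y := by
  have ht := h.symm_mem_target y (ball_subset_ball hs hy) hy0
  have hy' : L (extChartAt (𝓡∂ n) x ((extChartAt (𝓡∂ n) x).symm (L.symm y))) = y := by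
    rw [(extChartAt (𝓡∂ n) x).right_inv ht, L.apply_symm_apply]
  refine ⟨(extChartAt (𝓡∂ n) x).symm (L.symm y), ⟨?_, ?_⟩, hy'⟩
  · simpa only [extChartAt_source] using (extChartAt (𝓡∂ n) x).map_target ht
  · rwa [mem_preimage, hy']

/-- Being an interior point can be tested in the chart at `x`, whose target is relatively open in
the half-space, so the test is positivity of the zeroth coordinate, which `L` only rescales. -/
theorem mem_boundary_iff (h : IsNearIsometricChart x L lam r) {y : M}
    (hy : y ∈ (chartAt (EuclideanHalfSpace n) x).source) :
    y ∈ (𝓡∂ n).boundary M ↔ L (extChartAt (𝓡∂ n) x y) 0 = 0 := by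
  obtain ⟨c, hc, hL⟩ := h.exists_apply_zero
  rw [hL, mul_eq_zero, or_iff_right hc.ne']
  have h1 : y ∈ (𝓡∂ n).interior M ↔ extChartAt (𝓡∂ n) x y ∈ interior (extChartAt (𝓡∂ n) x).target :=
    (𝓡∂ n).isInteriorPoint_iff_of_mem_atlas (n := ∞) (by simp) (chart_mem_atlas _ x) hy
  have h2 : extChartAt (𝓡∂ n) x y ∈ interior (extChartAt (𝓡∂ n) x).target ↔
      0 < extChartAt (𝓡∂ n) x y 0 := by
    have h3 : extChartAt (𝓡∂ n) x y ∈ interior (extChartAt (𝓡∂ n) x).target ↔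
        extChartAt (𝓡∂ n) x y ∈ interior (range (𝓡∂ n)) := by
      have hnh : (extChartAt (𝓡∂ n) x).target ∈ 𝓝[range (𝓡∂ n)] (extChartAt (𝓡∂ n) x y) :=
        extChartAt_target_mem_nhdsWithin' (by simpa using hy)
      refine ⟨fun hi ↦ interior_mono (extChartAt_target_subset_range x) hi, fun hi ↦ ?_⟩
      rw [mem_interior_iff_mem_nhds] at hi ⊢
      rwa [nhdsWithin_eq_nhds.2 hi] at hnh
    rw [h3, interior_range_modelWithCornersEuclideanHalfSpace]
    rfl
  have h4 : (0 : ℝ) ≤ extChartAt (𝓡∂ n) x y 0 := by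
    have : extChartAt (𝓡∂ n) x y ∈ range (𝓡∂ n) := mem_range_self _
    rwa [range_modelWithCornersEuclideanHalfSpace] at this
  rw [← ModelWithCorners.compl_interior, mem_compl_iff, h1, h2, not_lt]
  exact ⟨fun h ↦ le_antisymm h h4, fun h ↦ h.le⟩

variable [MeasurableSpace M] [BorelSpace M]

theorem setLIntegral_comp_le (h : IsNearIsometricChart x L lam r)
    {F : EuclideanSpace ℝ (Fin n) → ℝ≥0∞} (hF : Measurable F) :
    ∫⁻ y in chartBall x L r, F (L (extChartAt (𝓡∂ n) x y)) ∂(riemVolume n M) ≤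
      (lam : ℝ≥0∞) ^ n *
        ∫⁻ y in ball (L (extChartAt (𝓡∂ n) x x)) r ∩ {y | 0 ≤ y 0}, F y := by
  have hm := (isOpen_chartBall x L r).measurableSet
  rw [← EuclideanSpace.euclideanHausdorffMeasure_eq_volume]
  exact setLIntegral_comp_le_of_edist_le h.edist_le n hm
    (t := ball (L (extChartAt (𝓡∂ n) x x)) r ∩ {y | 0 ≤ y 0})
    (fun y hy ↦ ⟨hy.2, h.apply_zero_nonneg y⟩)
    ((continuousOn_chartBall x L r).aemeasurable hm) hF

theorem riemVolume_chartBall_lt_top (h : IsNearIsometricChart x L lam r) :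
    riemVolume n M (chartBall x L r) < ⊤ := by
  have h1 := h.setLIntegral_comp_le (F := 1) measurable_one
  simp only [Pi.one_apply, lintegral_const, Measure.restrict_apply_univ, one_mul] at h1
  refine h1.trans_lt (ENNReal.mul_lt_top (by finiteness) ?_)
  exact (measure_mono inter_subset_left).trans_lt measure_ball_lt_top

end IsNearIsometricChart

end ChartVolume

/-! ### Boundary area in a near-isometric chart. -/

section ChartSurface

open Set Metric
open scoped NNReal

variable {m : ℕ} [NeZero (m + 1)] {M : Type*} [EMetricSpace M]
  [ChartedSpace (EuclideanHalfSpace (m + 1)) M]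
  [RiemannianBundle (fun x : M ↦ TangentSpace (𝓡∂ (m + 1)) x)] [IsManifold (𝓡∂ (m + 1)) ∞ M]
  [MeasurableSpace M] [BorelSpace M]

namespace IsNearIsometricChart

variable {x : M} {L : EuclideanSpace ℝ (Fin (m + 1)) ≃L[ℝ] EuclideanSpace ℝ (Fin (m + 1))}
  {lam : ℝ≥0} {r : ℝ}

omit [MeasurableSpace M] [BorelSpace M] in
theorem edist_euclideanTail (h : IsNearIsometricChart x L lam r)
    {y z : (𝓡∂ (m + 1)).boundary M} (hy : (y : M) ∈ chartBall x L r)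
    (hz : (z : M) ∈ chartBall x L r) :
    edist (euclideanTail (L (extChartAt (𝓡∂ (m + 1)) x y)))
      (euclideanTail (L (extChartAt (𝓡∂ (m + 1)) x z))) =
    edist (L (extChartAt (𝓡∂ (m + 1)) x y)) (L (extChartAt (𝓡∂ (m + 1)) x z)) := by
  rw [edist_dist, edist_dist, dist_eq_dist_euclideanTail]
  exact ((h.mem_boundary_iff hy.1).1 y.2).trans ((h.mem_boundary_iff hz.1).1 z.2).symm

theorem surfaceMeasure_chartBall_lt_top (h : IsNearIsometricChart x L lam r) :
    surfaceMeasure (m + 1) M (Subtype.val ⁻¹' chartBall x L r) < ⊤ := by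
  have h1 := euclideanHausdorffMeasure_le_of_edist_le (K := lam)
    (s := (Subtype.val ⁻¹' chartBall x L r : Set ((𝓡∂ (m + 1)).boundary M)))
    (f := fun y : (𝓡∂ (m + 1)).boundary M ↦ euclideanTail (L (extChartAt (𝓡∂ (m + 1)) x y)))
    (fun y hy z hz ↦ by
      rw [h.edist_euclideanTail hy hz]
      exact h.edist_le y hy z hz) m
  refine h1.trans_lt (ENNReal.mul_lt_top (by finiteness) ?_)
  rw [EuclideanSpace.euclideanHausdorffMeasure_eq_volume]
  refine (measure_mono (t := ball (euclideanTail (L (extChartAt (𝓡∂ (m + 1)) x x))) r)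
    ?_).trans_lt measure_ball_lt_top
  rintro _ ⟨y, hy, rfl⟩
  have := hy.2
  rw [mem_preimage, mem_ball, dist_eq_norm] at this
  rw [mem_ball, dist_eq_norm, ← euclideanTail_sub]
  exact (norm_euclideanTail_le _).trans_lt this

/-- The chart, restricted to the boundary and with its vanishing zeroth coordinate dropped, is
`lam`-Lipschitz and covers the whole flat ball. -/
theorem volume_ball_le_surfaceMeasure (h : IsNearIsometricChart x L lam r)
    (hx : x ∈ (𝓡∂ (m + 1)).boundary M) {s : ℝ} (hs : s ≤ r) :
    volume (ball (euclideanTail (L (extChartAt (𝓡∂ (m + 1)) x x))) s) ≤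
      (lam : ℝ≥0∞) ^ m * surfaceMeasure (m + 1) M (Subtype.val ⁻¹' chartBall x L s) := by
  have hL : LipschitzOnWith lam
      (fun y : (𝓡∂ (m + 1)).boundary M ↦ euclideanTail (L (extChartAt (𝓡∂ (m + 1)) x y)))
      (Subtype.val ⁻¹' chartBall x L s) := by
    intro y hy z hz
    have hy' := chartBall_mono x L hs hy
    have hz' := chartBall_mono x L hs hz
    rw [h.edist_euclideanTail hy' hz']
    exact h.edist_map_le y hy' z hz'
  refine le_trans ?_ (hL.euclideanHausdorffMeasure_image_le m)
  rw [EuclideanSpace.euclideanHausdorffMeasure_eq_volume]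
  refine measure_mono fun w hw ↦ ?_
  have hx0 := (h.mem_boundary_iff (mem_chart_source _ x)).1 hx
  let y : EuclideanSpace ℝ (Fin (m + 1)) := WithLp.toLp 2 (Fin.cons 0 w)
  have hyt : euclideanTail y = w := by
    ext i; simp [y, euclideanTail]
  have hy0 : y 0 = 0 := by simp [y]
  obtain ⟨z, hz, hzy⟩ := h.exists_mem_chartBall hs (y := y)
    (by rwa [mem_ball, dist_eq_dist_euclideanTail (hy0.trans hx0.symm), hyt]) hy0.ge
  refine ⟨⟨z, (h.mem_boundary_iff hz.1).2 (by rw [hzy, hy0])⟩, hz, ?_⟩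
  simp only [hzy, hyt]

end IsNearIsometricChart

end ChartSurface

/-! ### Finiteness of the measures, from local finiteness and compactness. -/

section FiniteMeasure

variable {n : ℕ} [NeZero n] {M : Type*} [EMetricSpace M] [CompactSpace M] [MeasurableSpace M]
  [BorelSpace M] [ChartedSpace (EuclideanHalfSpace n) M] [IsManifold (𝓡∂ n) ∞ M]
  [RiemannianBundle (fun x : M ↦ TangentSpace (𝓡∂ n) x)]
  [IsContinuousRiemannianBundle (EuclideanSpace ℝ (Fin n)) (fun x : M ↦ TangentSpace (𝓡∂ n) x)]
  [IsRiemannianManifold (𝓡∂ n) M]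

theorem isFiniteMeasure_riemVolume : IsFiniteMeasure (riemVolume n M) := by
  have : IsLocallyFiniteMeasure (riemVolume n M) := ⟨fun x ↦ by
    obtain ⟨L, r, h, -⟩ := exists_isNearIsometricChart (n := n) x univ_mem one_lt_two
    exact ⟨_, (isOpen_chartBall x L r).mem_nhds (mem_chartBall_self x L h.r_pos),
      h.riemVolume_chartBall_lt_top⟩⟩
  infer_instance

omit [CompactSpace M] [MeasurableSpace M] [BorelSpace M]
  [RiemannianBundle (fun x : M ↦ TangentSpace (𝓡∂ n) x)]
  [IsContinuousRiemannianBundle (EuclideanSpace ℝ (Fin n)) (fun x : M ↦ TangentSpace (𝓡∂ n) x)]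
  [IsRiemannianManifold (𝓡∂ n) M] in
theorem compactSpace_boundary [CompactSpace M] : CompactSpace ((𝓡∂ n).boundary M) :=
  isCompact_iff_compactSpace.1
    ((𝓡∂ n).isClosed_boundary (n := ∞) (by simp)).isCompact

theorem isFiniteMeasure_surfaceMeasure : IsFiniteMeasure (surfaceMeasure n M) := by
  have := compactSpace_boundary (n := n) (M := M)
  have : IsLocallyFiniteMeasure (surfaceMeasure n M) := ⟨fun x ↦ by
    obtain ⟨L, r, h, -⟩ := exists_isNearIsometricChart (n := n) x.1 univ_mem one_lt_two
    refine ⟨_, ((isOpen_chartBall x.1 L r).preimage continuous_subtype_val).mem_nhds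
      (mem_chartBall_self x.1 L h.r_pos), ?_⟩
    obtain ⟨m, rfl⟩ := Nat.exists_eq_succ_of_ne_zero (NeZero.ne n)
    exact h.surfaceMeasure_chartBall_lt_top⟩
  infer_instance

end FiniteMeasure

/-! ### The pointwise bound of the energy density. -/

section PowerEstimates

/-- Near 0 the weaker singularity is a small fraction of the stronger one, and away from 0 it is
bounded. Lower-order terms are absorbed this way. -/
theorem exists_rpow_neg_le {a b δ : ℝ} (ha : 0 ≤ a) (hab : a < b) (hδ : 0 < δ) :
    ∃ C : ℝ, 0 ≤ C ∧ ∀ z : ℝ, 0 < z → z ^ (-a) ≤ δ * z ^ (-b) + C := by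
  set z₀ := δ ^ (b - a)⁻¹ with hz₀
  have hba : 0 < b - a := by linarith
  have hz₀pos : 0 < z₀ := Real.rpow_pos_of_pos hδ _
  refine ⟨z₀ ^ (-a), by positivity, fun z hz ↦ ?_⟩
  have hb : 0 ≤ δ * z ^ (-b) := by positivity
  rcases le_total z z₀ with h | h
  · have h1 : z ^ (b - a) ≤ δ := by
      calc z ^ (b - a) ≤ z₀ ^ (b - a) := Real.rpow_le_rpow hz.le h hba.le
        _ = δ := by rw [hz₀, ← Real.rpow_mul hδ.le, inv_mul_cancel₀ hba.ne', Real.rpow_one]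
    have h2 : z ^ (-a) = z ^ (b - a) * z ^ (-b) := by
      rw [← Real.rpow_add hz]; congr 1; ring
    have h3 : z ^ (b - a) * z ^ (-b) ≤ δ * z ^ (-b) := by gcongr
    have h4 : 0 ≤ z₀ ^ (-a) := by positivity
    linarith
  · have h1 : z ^ (-a) ≤ z₀ ^ (-a) :=
      Real.rpow_le_rpow_of_nonpos hz₀pos h (by linarith)
    linarith

/-- For large w the ratio of 1 + w to w is close to 1. This handles the constant 1 added for
positivity. -/
theorem exists_one_add_rpow_le {q lam : ℝ} (hq : 0 ≤ q) (hlam : 1 < lam) :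
    ∃ C : ℝ, 0 ≤ C ∧ ∀ w : ℝ, 0 ≤ w → (1 + w) ^ q ≤ lam * w ^ q + C := by
  have hlim : Tendsto (fun t : ℝ ↦ (1 + t⁻¹) ^ q) atTop (𝓝 ((1 + 0) ^ q)) :=
    (tendsto_inv_atTop_zero.const_add 1).rpow_const (Or.inl (by simp))
  obtain ⟨W, hW, hW0⟩ := ((hlim.eventually_le_const (u := lam) (by simpa using hlam)).and
    (eventually_gt_atTop 0)).exists
  refine ⟨(1 + W) ^ q, by positivity, fun w hw ↦ ?_⟩
  rcases le_total W w with h | h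
  · have hw0 : 0 < w := hW0.trans_le h
    have h1 : (1 + w) ^ q = (1 + w⁻¹) ^ q * w ^ q := by
      rw [← Real.mul_rpow (by positivity) hw]; congr 1; field_simp; ring
    have h2 : (1 + w⁻¹) ^ q ≤ lam :=
      (Real.rpow_le_rpow (by positivity) (by gcongr) hq).trans hW
    have h3 : (1 + w⁻¹) ^ q * w ^ q ≤ lam * w ^ q := by gcongr
    have h4 : 0 ≤ (1 + W) ^ q := by positivity
    linarith
  · have h1 : (1 + w) ^ q ≤ (1 + W) ^ q := Real.rpow_le_rpow (by positivity) (by gcongr) hq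
    have h2 : 0 ≤ lam * w ^ q := by positivity
    linarith

theorem add_sq_le_mul_sq_add {lam : ℝ} (hlam : 1 < lam) (a b : ℝ) :
    (a + b) ^ 2 ≤ lam * a ^ 2 + lam / (lam - 1) * b ^ 2 := by
  have h : 0 < lam - 1 := by linarith
  have : lam * a ^ 2 + lam / (lam - 1) * b ^ 2 - (a + b) ^ 2 =
      ((lam - 1) * a - b) ^ 2 / (lam - 1) := by field_simp; ring
  have h2 : 0 ≤ ((lam - 1) * a - b) ^ 2 / (lam - 1) := by positivity
  linarith

set_option maxHeartbeats 1600000 in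
/-- Pointwise upper bound of the interior energy density of the concentrating functions. -/
theorem exists_energyDensity_le {n : ℕ} (hn : 3 ≤ n) {σ C₀ S₀ lam : ℝ} (hσ : 0 < σ)
    (hS₀ : 0 ≤ S₀) (hlam : 1 < lam) :
    ∃ C : ℝ, 0 ≤ C ∧ ∀ z u g k s : ℝ, 0 < z → 0 ≤ u → u ≤ z ^ (-(((n : ℝ) - 2) / 2)) → 0 ≤ g →
      g ≤ lam * (((n : ℝ) - 2) / 2 * σ * z ^ (-(((n : ℝ) - 2) / 2) - 1) +
        C₀ * z ^ (-(((n : ℝ) - 2) / 2))) →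
      s ≤ S₀ → 0 ≤ k → k ≤ lam * (σ ^ 2 * (n * (n - 1))) →
      2 * ((n : ℝ) - 1) / ((n : ℝ) - 2) * g ^ 2 + 1 / 2 * (s * (1 + u) ^ 2) +
        1 / criticalExponent n * (k * |1 + u| ^ criticalExponent n) ≤
      lam ^ 4 * ((n - 1) * (n - 2) * σ ^ 2) * z ^ (-(n : ℝ)) + C := by
  have hn' : (3 : ℝ) ≤ n := by exact_mod_cast hn
  have hP : criticalExponent n = 2 * (n : ℝ) / ((n : ℝ) - 2) := rfl
  generalize criticalExponent n = P at hP ⊢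
  generalize (n : ℝ) = N at hn' hP ⊢
  have hN2 : 0 < N - 2 := by linarith
  have hP0 : 0 < P := by rw [hP]; positivity
  set β := (N - 2) / 2 with hβ
  have hβ0 : 0 < β := by positivity
  set A := 2 * (N - 1) / (N - 2) with hA
  have hA0 : 0 < A := div_pos (by linarith) hN2
  set κ := (N - 1) * (N - 2) * σ ^ 2 with hκ
  have hκ0 : 0 < κ := mul_pos (mul_pos (by linarith) hN2) (by positivity)
  -- The two summands are equal: each is half of κ.
  have hκ_eq : A * (β * σ) ^ 2 + 1 / P * (σ ^ 2 * (N * (N - 1))) = κ := by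
    rw [hA, hP, hκ, hβ]; field_simp; ring
  set C₁ := lam / (lam - 1) with hC₁
  have hlam0 : 0 < lam := by linarith
  have hC₁0 : 0 ≤ C₁ := div_nonneg hlam0.le (by linarith)
  obtain ⟨C₂, hC₂, hpow⟩ := exists_one_add_rpow_le hP0.le hlam
  set B := A * lam ^ 2 * C₁ * C₀ ^ 2 + S₀ with hB
  have hB0 : 0 ≤ B := by positivity
  -- Absorbing the lower-order term `B * w ^ 2` then costs at most one further factor `lam` in the
  -- leading term; B + 1 is used since B may vanish.
  set δ := (lam ^ 4 - lam ^ 3) * κ / (B + 1) with hδ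
  have hlam43 : 0 < lam ^ 4 - lam ^ 3 := by
    have : lam ^ 4 - lam ^ 3 = lam ^ 3 * (lam - 1) := by ring
    rw [this]; exact mul_pos (by positivity) (by linarith)
  have hδ0 : 0 < δ := by positivity
  have hBδ : B * δ ≤ (lam ^ 4 - lam ^ 3) * κ := by
    rw [hδ, mul_div_assoc', div_le_iff₀ (by positivity)]
    nlinarith [mul_pos hlam43 hκ0]
  obtain ⟨C₃, hC₃, hY⟩ := exists_rpow_neg_le hN2.le (show N - 2 < N by linarith) hδ0
  refine ⟨B * C₃ + S₀ + 1 / P * (lam * (σ ^ 2 * (N * (N - 1))) * C₂), ?_, ?_⟩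
  · have : 0 ≤ N * (N - 1) := mul_nonneg (by linarith) (by linarith)
    positivity
  intro z u g k s hz hu huw hg hgle hs hk hkle
  set w := z ^ (-β) with hw
  set d := z ^ (-β - 1) with hd
  have hw0 : 0 ≤ w := by positivity
  have hd0 : 0 ≤ d := by positivity
  have hw2 : w ^ 2 = z ^ (-(N - 2)) := by
    rw [hw, ← Real.rpow_natCast, ← Real.rpow_mul hz.le]; congr 1; push_cast; rw [hβ]; ring
  have hd2 : d ^ 2 = z ^ (-N) := by
    rw [hd, ← Real.rpow_natCast, ← Real.rpow_mul hz.le]; congr 1; push_cast; rw [hβ]; ring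
  have hwP : w ^ P = z ^ (-N) := by
    rw [hw, ← Real.rpow_mul hz.le]; congr 1; rw [hP, hβ]; field_simp
  have hYz := hY z hz
  rw [← hw2] at hYz
  set X := z ^ (-N) with hX
  have hX0 : 0 ≤ X := by positivity
  have e1 : g ^ 2 ≤ lam ^ 2 * (lam * ((β * σ) ^ 2 * X) + C₁ * (C₀ ^ 2 * w ^ 2)) := by
    have h1 : g ^ 2 ≤ (lam * (β * σ * d + C₀ * w)) ^ 2 := by gcongr
    have h2 := add_sq_le_mul_sq_add hlam (β * σ * d) (C₀ * w)
    have h3 : (β * σ * d) ^ 2 = (β * σ) ^ 2 * X := by rw [mul_pow, hd2]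
    have h4 : (C₀ * w) ^ 2 = C₀ ^ 2 * w ^ 2 := by ring
    rw [h3, h4] at h2
    rw [mul_pow] at h1
    exact h1.trans (by gcongr)
  have e2 : s * (1 + u) ^ 2 ≤ 2 * S₀ + 2 * S₀ * w ^ 2 := by
    have h1 : (1 + u) ^ 2 ≤ 2 + 2 * w ^ 2 := by nlinarith [sq_nonneg (1 - w)]
    calc s * (1 + u) ^ 2 ≤ S₀ * (1 + u) ^ 2 := by gcongr
      _ ≤ S₀ * (2 + 2 * w ^ 2) := by gcongr
      _ = _ := by ring
  have e3 : k * |1 + u| ^ P ≤ lam * (σ ^ 2 * (N * (N - 1))) * (lam * X + C₂) := by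
    rw [abs_of_nonneg (by linarith)]
    have h1 : (1 + u) ^ P ≤ (1 + w) ^ P :=
      Real.rpow_le_rpow (by linarith) (by linarith) hP0.le
    have h2 := hpow w hw0
    rw [hwP] at h2
    have h3 : 0 ≤ (1 + u) ^ P := Real.rpow_nonneg (by linarith) _
    calc k * (1 + u) ^ P ≤ lam * (σ ^ 2 * (N * (N - 1))) * (1 + u) ^ P := by gcongr
      _ ≤ _ := mul_le_mul_of_nonneg_left (h1.trans h2) (hk.trans hkle)
  -- The gradient term carries `lam ^ 2` from the bound on `g` and one `lam` from splitting the
  -- square; the K term carries one `lam` from `k` and one from removing the 1.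
  have hlam23 : lam ^ 2 ≤ lam ^ 3 := pow_le_pow_right₀ hlam.le (by norm_num)
  have hP' : 0 < 1 / P := by positivity
  have hNN : 0 ≤ N * (N - 1) := mul_nonneg (by linarith) (by linarith)
  calc A * g ^ 2 + 1 / 2 * (s * (1 + u) ^ 2) + 1 / P * (k * |1 + u| ^ P)
      ≤ A * (lam ^ 2 * (lam * ((β * σ) ^ 2 * X) + C₁ * (C₀ ^ 2 * w ^ 2))) +
        1 / 2 * (2 * S₀ + 2 * S₀ * w ^ 2) +
        1 / P * (lam * (σ ^ 2 * (N * (N - 1))) * (lam * X + C₂)) := by gcongr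
    _ = lam ^ 3 * (A * (β * σ) ^ 2) * X + lam ^ 2 * (1 / P * (σ ^ 2 * (N * (N - 1)))) * X +
        B * w ^ 2 + (S₀ + 1 / P * (lam * (σ ^ 2 * (N * (N - 1))) * C₂)) := by rw [hB]; ring
    _ ≤ lam ^ 3 * (A * (β * σ) ^ 2) * X + lam ^ 3 * (1 / P * (σ ^ 2 * (N * (N - 1)))) * X +
        B * (δ * X + C₃) + (S₀ + 1 / P * (lam * (σ ^ 2 * (N * (N - 1))) * C₂)) := by gcongr
    _ = lam ^ 3 * κ * X + B * δ * X +
        (B * C₃ + S₀ + 1 / P * (lam * (σ ^ 2 * (N * (N - 1))) * C₂)) := by rw [← hκ_eq]; ring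
    _ ≤ lam ^ 3 * κ * X + (lam ^ 4 - lam ^ 3) * κ * X +
        (B * C₃ + S₀ + 1 / P * (lam * (σ ^ 2 * (N * (N - 1))) * C₂)) := by gcongr
    _ = _ := by ring

end PowerEstimates

/-! ### The concentrating profile in Euclidean space. -/

section BoundaryLayer

variable {n : ℕ} [NeZero n]

/-- The function `χ(y) (σ (y₀ + ε))^(-β)` on Euclidean space, which concentrates near `y₀ = 0`. -/
noncomputable def boundaryLayer (χ : EuclideanSpace ℝ (Fin n) → ℝ) (σ β ε : ℝ)
    (y : EuclideanSpace ℝ (Fin n)) : ℝ :=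
  χ y * (σ * (y 0 + ε)) ^ (-β)

variable {χ : EuclideanSpace ℝ (Fin n) → ℝ} {σ β ε : ℝ} {y : EuclideanSpace ℝ (Fin n)}

theorem contDiffAt_boundaryLayer (hχ : ContDiff ℝ ∞ χ) (hσ : 0 < σ) (hε : 0 < ε) (hy : 0 ≤ y 0) :
    ContDiffAt ℝ ∞ (boundaryLayer χ σ β ε) y := by
  have h1 : ContDiffAt ℝ ∞ (fun y : EuclideanSpace ℝ (Fin n) ↦ σ * (y 0 + ε)) y := by
    have : ContDiff ℝ ∞ (fun y : EuclideanSpace ℝ (Fin n) ↦ y 0) :=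
      (EuclideanSpace.proj (0 : Fin n) : EuclideanSpace ℝ (Fin n) →L[ℝ] ℝ).contDiff
    exact (contDiff_const.mul (this.add contDiff_const)).contDiffAt
  exact hχ.contDiffAt.mul (h1.rpow_const_of_ne (by positivity))

theorem norm_fderiv_boundaryLayer_le {C₀ : ℝ} (hχ : ContDiff ℝ ∞ χ) (hχ0 : 0 ≤ χ y)
    (hχ1 : χ y ≤ 1) (hC₀ : ‖fderiv ℝ χ y‖ ≤ C₀) (hσ : 0 < σ) (hβ : 0 ≤ β) (hε : 0 < ε)
    (hy : 0 ≤ y 0) :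
    ‖fderiv ℝ (boundaryLayer χ σ β ε) y‖ ≤
      β * σ * (σ * (y 0 + ε)) ^ (-β - 1) + C₀ * (σ * (y 0 + ε)) ^ (-β) := by
  have hz : 0 < σ * (y 0 + ε) := by positivity
  let P : EuclideanSpace ℝ (Fin n) →L[ℝ] ℝ := EuclideanSpace.proj 0
  have hP : ‖P‖ ≤ 1 := P.opNorm_le_bound zero_le_one fun v ↦ by
    rw [one_mul]; exact PiLp.norm_apply_le v 0
  have h1 : HasFDerivAt (fun y : EuclideanSpace ℝ (Fin n) ↦ σ * (y 0 + ε)) (σ • P) y :=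
    (P.hasFDerivAt.add_const ε).const_mul σ
  have h2 := h1.rpow_const (p := -β) (Or.inl hz.ne')
  have h3 := ((hχ.differentiable (by simp) y).hasFDerivAt.mul h2).fderiv
  have h4 : fderiv ℝ (boundaryLayer χ σ β ε) y = _ := h3
  rw [h4]
  refine (norm_add_le _ _).trans ?_
  rw [norm_smul, norm_smul, norm_smul, norm_smul, Real.norm_of_nonneg hχ0,
    Real.norm_of_nonneg hσ.le, Real.norm_of_nonneg (Real.rpow_nonneg hz.le _), norm_mul, norm_neg,
    Real.norm_of_nonneg hβ, Real.norm_of_nonneg (Real.rpow_nonneg hz.le _), mul_comm C₀]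
  refine add_le_add ?_ (by gcongr)
  calc χ y * (β * (σ * (y 0 + ε)) ^ (-β - 1) * (σ * ‖P‖))
      ≤ 1 * (β * (σ * (y 0 + ε)) ^ (-β - 1) * (σ * 1)) := by gcongr
    _ = _ := by ring

end BoundaryLayer

/-! ### Volume and area bounds in terms of one Euclidean ball. -/

section ChartVolumeRatio

open Set Metric
open scoped NNReal

variable {n : ℕ} [NeZero n] {M : Type*} [EMetricSpace M] [MeasurableSpace M] [BorelSpace M]
  [ChartedSpace (EuclideanHalfSpace n) M]
  [RiemannianBundle (fun x : M ↦ TangentSpace (𝓡∂ n) x)] [IsManifold (𝓡∂ n) ∞ M]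
  {x : M} {L : EuclideanSpace ℝ (Fin n) ≃L[ℝ] EuclideanSpace ℝ (Fin n)} {lam : ℝ≥0} {r : ℝ}

/-- The number `v` is the volume of the `(n - 1)`-dimensional Euclidean ball of radius `r`. -/
theorem IsNearIsometricChart.exists_volume_bounds (h : IsNearIsometricChart x L lam r)
    (hx : x ∈ (𝓡∂ n).boundary M) :
    ∃ v : ℝ, 0 < v ∧
      (∀ g : ℝ → ℝ≥0∞, Measurable g →
        ∫⁻ y in chartBall x L r, g (L (extChartAt (𝓡∂ n) x y) 0) ∂(riemVolume n M) ≤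
          ENNReal.ofReal ((lam : ℝ) ^ n * v) * ∫⁻ s in Ici 0, g s) ∧
      ∀ s : ℝ, 1 ≤ s → ENNReal.ofReal v ≤ ENNReal.ofReal (((lam : ℝ) * s) ^ (n - 1)) *
        surfaceMeasure n M (Subtype.val ⁻¹' chartBall x L (r / s)) := by
  obtain ⟨m, rfl⟩ := Nat.exists_eq_succ_of_ne_zero (NeZero.ne n)
  have hr := h.r_pos
  set q := euclideanTail (L (extChartAt (𝓡∂ (m + 1)) x x)) with hq
  have hne : volume (ball q r) ≠ ⊤ := measure_ball_lt_top.ne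
  refine ⟨(volume (ball q r)).toReal, ENNReal.toReal_pos (measure_ball_pos _ _ hr).ne' hne,
    fun g hg ↦ ?_, fun s hs ↦ ?_⟩
  · refine (h.setLIntegral_comp_le (F := fun y ↦ g (y 0)) (by fun_prop)).trans ?_
    rw [ENNReal.ofReal_mul (by positivity), ENNReal.ofReal_toReal hne,
      ENNReal.ofReal_pow (by positivity), ENNReal.ofReal_coe_nnreal, mul_assoc]
    gcongr
    exact setLIntegral_halfBall_comp_zero_le r hg
  · have hs0 : 0 < s := by linarith
    have h1 := h.volume_ball_le_surfaceMeasure hx (div_le_self hr.le hs)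
    -- Scaling in dimension m = n - 1 measures the loss from passing to the smaller ball, on which
    -- the cutoff will be 1.
    have h2 : volume (ball q r) = ENNReal.ofReal (s ^ m) * volume (ball q (r / s)) := by
      have := Measure.addHaar_ball_mul_of_pos volume q hs0 (r / s)
      rw [mul_div_cancel₀ _ hs0.ne'] at this
      rw [this, Measure.addHaar_ball_center volume q (r / s)]
      simp
    rw [ENNReal.ofReal_toReal hne, h2, mul_pow, ENNReal.ofReal_mul (by positivity),
      mul_comm (ENNReal.ofReal (lam ^ _)), mul_assoc]
    gcongr
    · simp
    · rw [ENNReal.ofReal_pow (by positivity), ENNReal.ofReal_coe_nnreal]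
      exact h1

end ChartVolumeRatio

/-! ### Transplanting the profile to the manifold. -/

section ChartExtension

open Set Metric
open scoped NNReal

variable {n : ℕ} [NeZero n] {M : Type*} [EMetricSpace M]
  [ChartedSpace (EuclideanHalfSpace n) M]

/-- The function `1 + U` in the chart at `x` followed by `L`, extended by `1`. -/
noncomputable def chartExtension (x : M)
    (L : EuclideanSpace ℝ (Fin n) ≃L[ℝ] EuclideanSpace ℝ (Fin n)) (r : ℝ)
    (U : EuclideanSpace ℝ (Fin n) → ℝ) (y : M) : ℝ :=
  1 + (chartBall x L r).indicator (fun y ↦ U (L (extChartAt (𝓡∂ n) x y))) y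

variable [RiemannianBundle (fun x : M ↦ TangentSpace (𝓡∂ n) x)] [IsManifold (𝓡∂ n) ∞ M]
  {x : M} {L : EuclideanSpace ℝ (Fin n) ≃L[ℝ] EuclideanSpace ℝ (Fin n)} {lam : ℝ≥0} {r s : ℝ}
  {U : EuclideanSpace ℝ (Fin n) → ℝ} {y : M}

omit [RiemannianBundle (fun x : M ↦ TangentSpace (𝓡∂ n) x)] [IsManifold (𝓡∂ n) ∞ M] in
theorem chartExtension_of_mem (hy : y ∈ chartBall x L r) :
    chartExtension x L r U y = 1 + U (L (extChartAt (𝓡∂ n) x y)) := by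
  simp [chartExtension, indicator_of_mem hy, -extChartAt]

omit [RiemannianBundle (fun x : M ↦ TangentSpace (𝓡∂ n) x)] [IsManifold (𝓡∂ n) ∞ M] in
theorem chartExtension_of_notMem (hy : y ∉ chartBall x L r) : chartExtension x L r U y = 1 := by
  simp [chartExtension, indicator_of_notMem hy]

omit [RiemannianBundle (fun x : M ↦ TangentSpace (𝓡∂ n) x)] [IsManifold (𝓡∂ n) ∞ M] in
theorem chartExtension_eventuallyEq_of_mem (hy : y ∈ chartBall x L r) :
    chartExtension x L r U =ᶠ[𝓝 y] (fun y ↦ 1 + U (L (extChartAt (𝓡∂ n) x y))) := by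
  filter_upwards [(isOpen_chartBall x L r).mem_nhds hy] with z hz using chartExtension_of_mem hz

/-- The closed half-ball carrying `U` has compact image under the inverse chart. That image is
closed in M, so its complement is a neighbourhood of `y`. -/
theorem IsNearIsometricChart.chartExtension_eventuallyEq_one (h : IsNearIsometricChart x L lam r)
    (hs : s < r) (hU : ∀ y ∉ closedBall (L (extChartAt (𝓡∂ n) x x)) s, U y = 0)
    (hy : y ∉ chartBall x L r) : chartExtension x L r U =ᶠ[𝓝 y] fun _ ↦ 1 := by
  set T := closedBall (L (extChartAt (𝓡∂ n) x x)) s ∩ {y | 0 ≤ y 0} with hT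
  have hTc : IsCompact T := (isCompact_closedBall _ _).inter_right
    (isClosed_le continuous_const (by fun_prop))
  have hTt : ∀ z ∈ T, L.symm z ∈ (extChartAt (𝓡∂ n) x).target := fun z hz ↦
    h.symm_mem_target z (closedBall_subset_ball hs hz.1) hz.2
  set Z := (fun z ↦ (extChartAt (𝓡∂ n) x).symm (L.symm z)) '' T with hZ
  have hZc : IsClosed Z := (hTc.image_of_continuousOn
    ((continuousOn_extChartAt_symm x).comp L.symm.continuous.continuousOn hTt)).isClosed
  have hyZ : y ∉ Z := by
    rintro ⟨z, hz, rfl⟩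
    refine hy ⟨?_, ?_⟩
    · simpa only [extChartAt_source] using (extChartAt (𝓡∂ n) x).map_target (hTt z hz)
    · rw [mem_preimage, (extChartAt (𝓡∂ n) x).right_inv (hTt z hz), L.apply_symm_apply]
      exact closedBall_subset_ball hs hz.1
  filter_upwards [hZc.isOpen_compl.mem_nhds hyZ] with z hz
  by_cases hzV : z ∈ chartBall x L r
  · rw [chartExtension_of_mem hzV, hU, add_zero]
    intro hzs
    refine hz ⟨_, ⟨hzs, h.apply_zero_nonneg z⟩, ?_⟩
    simp only [L.symm_apply_apply]
    exact (extChartAt (𝓡∂ n) x).left_inv (by simpa using hzV.1)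
  · exact chartExtension_of_notMem hzV

theorem IsNearIsometricChart.contMDiff_chartExtension (h : IsNearIsometricChart x L lam r)
    (hs : s < r) (hU : ∀ y ∉ closedBall (L (extChartAt (𝓡∂ n) x x)) s, U y = 0)
    (hUs : ∀ y, 0 ≤ y 0 → ContDiffAt ℝ ∞ U y) :
    ContMDiff (𝓡∂ n) 𝓘(ℝ, ℝ) ∞ (chartExtension x L r U) := by
  intro y
  by_cases hy : y ∈ chartBall x L r
  · refine ContMDiffAt.congr_of_eventuallyEq ?_ (chartExtension_eventuallyEq_of_mem hy)
    have h1 : ContMDiffAt (𝓡∂ n) 𝓘(ℝ, EuclideanSpace ℝ (Fin n)) ∞ (extChartAt (𝓡∂ n) x) y :=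
      contMDiffAt_extChartAt' hy.1
    have h2 : ContDiffAt ℝ ∞ (fun e ↦ 1 + U (L e)) (extChartAt (𝓡∂ n) x y) :=
      contDiffAt_const.add ((hUs _ (h.apply_zero_nonneg y)).comp (extChartAt (𝓡∂ n) x y)
        L.contDiff.contDiffAt)
    exact h2.contMDiffAt.comp y h1
  · exact contMDiffAt_const.congr_of_eventuallyEq (h.chartExtension_eventuallyEq_one hs hU hy)

theorem IsNearIsometricChart.riemGradient_chartExtension_of_notMem
    (h : IsNearIsometricChart x L lam r) (hs : s < r)
    (hU : ∀ y ∉ closedBall (L (extChartAt (𝓡∂ n) x x)) s, U y = 0)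
    (hy : y ∉ chartBall x L r) : riemGradient (n := n) (chartExtension x L r U) y = 0 := by
  refine ext_inner_right ℝ fun v ↦ ?_
  rw [inner_riemGradient, (h.chartExtension_eventuallyEq_one hs hU hy).mfderiv_eq, mfderiv_const,
    inner_zero_left]
  rfl

theorem IsNearIsometricChart.norm_riemGradient_chartExtension_le
    (h : IsNearIsometricChart x L lam r)
    (hUs : ∀ y, 0 ≤ y 0 → ContDiffAt ℝ ∞ U y) (hy : y ∈ chartBall x L r) :
    ‖riemGradient (n := n) (chartExtension x L r U) y‖ ≤
      lam * ‖fderiv ℝ U (L (extChartAt (𝓡∂ n) x y))‖ := by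
  refine norm_le_of_forall_inner_le (by positivity) fun v ↦ ?_
  set e := extChartAt (𝓡∂ n) x y with he
  have hd : DifferentiableAt ℝ U (L e) :=
    (hUs _ (h.apply_zero_nonneg y)).differentiableAt (by simp)
  have h2 : HasFDerivAt (fun e ↦ 1 + U (L e)) ((fderiv ℝ U (L e)) ∘L (L : _ →L[ℝ] _)) e :=
    (hd.hasFDerivAt.comp e L.hasFDerivAt).const_add 1
  have h3 : MDifferentiableAt (𝓡∂ n) 𝓘(ℝ, EuclideanSpace ℝ (Fin n)) (extChartAt (𝓡∂ n) x) y :=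
    mdifferentiableAt_extChartAt hy.1
  have h4 : mfderiv (𝓡∂ n) 𝓘(ℝ, ℝ) (chartExtension x L r U) y v =
      fderiv ℝ U (L e) (L ((trivializationAt (EuclideanSpace ℝ (Fin n))
        (fun x : M ↦ TangentSpace (𝓡∂ n) x) x).continuousLinearMapAt ℝ y v)) := by
    rw [(chartExtension_eventuallyEq_of_mem hy).mfderiv_eq,
      TangentBundle.continuousLinearMapAt_trivializationAt hy.1]
    have h5 := (h2.hasMFDerivAt.comp y h3.hasMFDerivAt).mfderiv
    exact congr($h5 v)
  rw [inner_riemGradient, h4]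
  refine (le_abs_self _).trans (((fderiv ℝ U (L e)).le_opNorm _).trans ?_)
  have := h.norm_map_le y hy v
  calc _ ≤ ‖fderiv ℝ U (L e)‖ * (lam * ‖v‖) := by gcongr
    _ = _ := by ring

end ChartExtension

/-! ### Convergence of the energy and its interior density. -/

section EnergyEstimate

open Set Metric
open scoped NNReal

theorem integral_le_of_lintegral_ofReal_le {X : Type*} [MeasurableSpace X] {μ : Measure X}
    {f : X → ℝ} (hf : Integrable f μ) {b : ℝ} (hb : 0 ≤ b)
    (h : ∫⁻ x, ENNReal.ofReal (f x) ∂μ ≤ ENNReal.ofReal b) : ∫ x, f x ∂μ ≤ b := by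
  rw [integral_eq_lintegral_pos_part_sub_lintegral_neg_part hf]
  have h1 := ENNReal.toReal_mono ENNReal.ofReal_ne_top h
  rw [ENNReal.toReal_ofReal hb] at h1
  exact (sub_le_self _ ENNReal.toReal_nonneg).trans h1

theorem exists_abs_le_of_compactSpace {X : Type*} [TopologicalSpace X] [CompactSpace X]
    {f : X → ℝ} (hf : Continuous f) : ∃ C : ℝ, 0 ≤ C ∧ ∀ x, |f x| ≤ C := by
  obtain ⟨C, hC⟩ := isCompact_univ.exists_bound_of_continuousOn hf.continuousOn
  exact ⟨max C 0, le_max_right _ _, fun x ↦ (hC x (mem_univ x)).trans (le_max_left _ _)⟩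

variable {n : ℕ} [NeZero n] {M : Type*} [EMetricSpace M] [CompactSpace M] [MeasurableSpace M]
  [BorelSpace M] [ChartedSpace (EuclideanHalfSpace n) M] [IsManifold (𝓡∂ n) ∞ M]
  [RiemannianBundle (fun x : M ↦ TangentSpace (𝓡∂ n) x)]
  [IsContinuousRiemannianBundle (EuclideanSpace ℝ (Fin n)) (fun x : M ↦ TangentSpace (𝓡∂ n) x)]

theorem continuous_mul_abs_rpow {X : Type*} [TopologicalSpace X] {f u : X → ℝ}
    (hf : Continuous f) (hu : Continuous u) {P : ℝ} (hP : 0 ≤ P) :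
    Continuous (fun x ↦ f x * |u x| ^ P) :=
  hf.mul (hu.abs.rpow_const fun _ ↦ Or.inr hP)

omit [NeZero n] in
theorem criticalExponent_nonneg (hn : 3 ≤ n) : 0 ≤ criticalExponent n := by
  have : (3 : ℝ) ≤ n := by exact_mod_cast hn
  exact div_nonneg (by linarith) (by linarith)

omit [NeZero n] in
theorem criticalTraceExponent_nonneg (hn : 3 ≤ n) : 0 ≤ criticalTraceExponent n := by
  have : (3 : ℝ) ≤ n := by exact_mod_cast hn
  exact div_nonneg (by linarith) (by linarith)

theorem energyConverges_ofSmooth [IsRiemannianManifold (𝓡∂ n) M] (hn : 3 ≤ n) {S K : M → ℝ}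
    (hS : Continuous S) (hK : Continuous K) {H : (𝓡∂ n).boundary M → ℝ} (hH : Continuous H)
    {f : M → ℝ} (hf : ContMDiff (𝓡∂ n) 𝓘(ℝ, ℝ) ∞ f) :
    EnergyConverges S K H (SobolevH1.ofSmooth f hf) := by
  have := isFiniteMeasure_riemVolume (n := n) (M := M)
  have := isFiniteMeasure_surfaceMeasure (n := n) (M := M)
  have := compactSpace_boundary (n := n) (M := M)
  have hfc := hf.continuous
  have hfb : Continuous (fun y : (𝓡∂ n).boundary M ↦ f y) := hfc.comp continuous_subtype_val
  have h1 : Continuous (fun x ↦ ‖riemGradient (n := n) f x‖ ^ 2) :=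
    (continuous_norm_riemGradient hf).pow 2
  have h2 : Continuous (fun x ↦ S x * f x ^ 2) := hS.mul (hfc.pow 2)
  have h3 := continuous_mul_abs_rpow hK hfc (criticalExponent_nonneg hn)
  have h4 := continuous_mul_abs_rpow hH hfb (criticalTraceExponent_nonneg hn)
  exact ⟨h1.integrable_of_hasCompactSupport (.of_compactSpace _),
    h2.integrable_of_hasCompactSupport (.of_compactSpace _),
    h3.integrable_of_hasCompactSupport (.of_compactSpace _),
    h4.integrable_of_hasCompactSupport (.of_compactSpace _)⟩

-- The interior terms are gathered under one integral so that a pointwise bound of the density can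
-- be integrated.
omit [CompactSpace M] [IsManifold (𝓡∂ n) ∞ M]
  [IsContinuousRiemannianBundle (EuclideanSpace ℝ (Fin n)) (fun x : M ↦ TangentSpace (𝓡∂ n) x)] in
theorem energy_eq_integral_sub {S K : M → ℝ} {H : (𝓡∂ n).boundary M → ℝ} {u : SobolevH1 n M}
    (hu : EnergyConverges S K H u) :
    Integrable (fun x ↦ 2 * ((n : ℝ) - 1) / ((n : ℝ) - 2) * ‖u.grad x‖ ^ 2 +
      1 / 2 * (S x * u.toFun x ^ 2) +
        1 / criticalExponent n * (-K x * |u.toFun x| ^ criticalExponent n)) (riemVolume n M) ∧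
    energy S K H u = ∫ x, (2 * ((n : ℝ) - 1) / ((n : ℝ) - 2) * ‖u.grad x‖ ^ 2 +
      1 / 2 * (S x * u.toFun x ^ 2) +
        1 / criticalExponent n * (-K x * |u.toFun x| ^ criticalExponent n)) ∂(riemVolume n M) -
      ((n : ℝ) - 2) *
        ∫ y, H y * |u.trace y| ^ criticalTraceExponent n ∂(surfaceMeasure n M) := by
  obtain ⟨h1, h2, h3, -⟩ := hu
  have h1' := h1.const_mul (2 * ((n : ℝ) - 1) / ((n : ℝ) - 2))
  have h2' := h2.const_mul (1 / 2)
  have h3' : Integrable (fun x ↦ 1 / criticalExponent n *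
      (-K x * |u.toFun x| ^ criticalExponent n)) (riemVolume n M) := by
    simpa only [neg_mul, Pi.neg_apply] using h3.neg.const_mul (1 / criticalExponent n)
  have h12 : Integrable (fun x ↦ 2 * ((n : ℝ) - 1) / ((n : ℝ) - 2) * ‖u.grad x‖ ^ 2 +
      1 / 2 * (S x * u.toFun x ^ 2)) (riemVolume n M) := h1'.add h2'
  refine ⟨h12.add h3', ?_⟩
  rw [integral_add h12 h3', integral_add h1' h2', integral_const_mul,
    integral_const_mul, integral_const_mul]
  simp only [neg_mul, integral_neg]
  unfold energy
  ring

end EnergyEstimate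

/-! ### Interior and boundary energy of the concentrating functions. -/

section ConcentratingEnergy

open Set Metric
open scoped NNReal

variable {n : ℕ} [NeZero n] {M : Type*} [EMetricSpace M] [CompactSpace M] [MeasurableSpace M]
  [BorelSpace M] [ChartedSpace (EuclideanHalfSpace n) M] [IsManifold (𝓡∂ n) ∞ M]
  [RiemannianBundle (fun x : M ↦ TangentSpace (𝓡∂ n) x)]
  [IsContinuousRiemannianBundle (EuclideanSpace ℝ (Fin n)) (fun x : M ↦ TangentSpace (𝓡∂ n) x)]
  [IsRiemannianManifold (𝓡∂ n) M]
  {x : M} {L : EuclideanSpace ℝ (Fin n) ≃L[ℝ] EuclideanSpace ℝ (Fin n)} {lam : ℝ≥0} {r : ℝ}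

omit [CompactSpace M] [MeasurableSpace M] [BorelSpace M] [IsRiemannianManifold (𝓡∂ n) M]
  [IsContinuousRiemannianBundle (EuclideanSpace ℝ (Fin n)) (fun x : M ↦ TangentSpace (𝓡∂ n) x)] in
theorem IsNearIsometricChart.contMDiff_boundaryLayer (h : IsNearIsometricChart x L lam r)
    (χ : ContDiffBump (L (extChartAt (𝓡∂ n) x x))) (hχ : χ.rOut < r) {σ β ε : ℝ} (hσ : 0 < σ)
    (hε : 0 < ε) :
    ContMDiff (𝓡∂ n) 𝓘(ℝ, ℝ) ∞ (chartExtension x L r (boundaryLayer χ σ β ε)) := by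
  refine h.contMDiff_chartExtension hχ (fun y hy ↦ ?_)
    (fun y hy ↦ contDiffAt_boundaryLayer χ.contDiff hσ hε hy)
  rw [boundaryLayer, χ.zero_of_le_dist (le_of_lt (by simpa using hy)), zero_mul]

/-- The interior part of the energy of the concentrating functions. -/
theorem IsNearIsometricChart.exists_integral_energyDensity_le (h : IsNearIsometricChart x L lam r)
    (hn : 3 ≤ n) (hlam : 1 < lam) {S K : M → ℝ} (hS : Continuous S) (hK : Continuous K)
    (hK0 : ∀ y, K y < 0) {H : (𝓡∂ n).boundary M → ℝ} (hH : Continuous H) {σ : ℝ} (hσ : 0 < σ)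
    (hKV : ∀ y ∈ chartBall x L r, -K y ≤ lam * (σ ^ 2 * (n * (n - 1)))) {v : ℝ} (hv : 0 < v)
    (hvol : ∀ g : ℝ → ℝ≥0∞, Measurable g →
        ∫⁻ y in chartBall x L r, g (L (extChartAt (𝓡∂ n) x y) 0) ∂(riemVolume n M) ≤
          ENNReal.ofReal ((lam : ℝ) ^ n * v) * ∫⁻ s in Ici 0, g s)
    (χ : ContDiffBump (L (extChartAt (𝓡∂ n) x x))) (hχ : χ.rOut < r) :
    ∃ C : ℝ, ∀ ε (hε : 0 < ε), energy S K H (SobolevH1.ofSmooth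
        (chartExtension x L r (boundaryLayer χ σ (((n : ℝ) - 2) / 2) ε))
        (h.contMDiff_boundaryLayer χ hχ hσ hε)) ≤
      C + (lam : ℝ) ^ (n + 4) * ((n - 2) * σ) * v * (σ * ε) ^ (1 - (n : ℝ)) - ((n : ℝ) - 2) *
        ∫ y, H y * |chartExtension x L r (boundaryLayer χ σ (((n : ℝ) - 2) / 2) ε) y| ^
          criticalTraceExponent n ∂(surfaceMeasure n M) := by
  have hn' : (3 : ℝ) ≤ n := by exact_mod_cast hn
  have hfin := isFiniteMeasure_riemVolume (n := n) (M := M)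
  have hlam' : (1 : ℝ) < lam := by exact_mod_cast hlam
  obtain ⟨S₀, hS₀, hSb⟩ := exists_abs_le_of_compactSpace hS
  obtain ⟨K₀, hK₀, hKb⟩ := exists_abs_le_of_compactSpace hK
  obtain ⟨C₀, hC₀⟩ := (χ.contDiff (n := 1).continuous_fderiv
    one_ne_zero).bounded_above_of_compact_support (χ.hasCompactSupport.fderiv (𝕜 := ℝ))
  obtain ⟨C₁, hC₁, hdens⟩ := exists_energyDensity_le (C₀ := C₀) hn hσ hS₀ hlam'
  -- `C₁` serves inside the chart ball; the other terms bound the density outside, where the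
  -- function is 1 and its gradient is 0.
  set C₂ := C₁ + S₀ + 1 / criticalExponent n * K₀ with hC₂
  set κ := (lam : ℝ) ^ 4 * ((n - 1) * (n - 2) * σ ^ 2) with hκ
  have hκ0 : 0 ≤ κ := by
    have h1 : (0 : ℝ) ≤ n - 1 := by linarith
    have h2 : (0 : ℝ) ≤ n - 2 := by linarith
    positivity
  have hP0 := criticalExponent_nonneg hn
  refine ⟨C₂ * (riemVolume n M).real univ, fun ε hε ↦ ?_⟩
  set β := ((n : ℝ) - 2) / 2 with hβ
  have hβ0 : 0 ≤ β := by rw [hβ]; linarith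
  set U := boundaryLayer (χ : EuclideanSpace ℝ (Fin n) → ℝ) σ β ε with hU
  set f := chartExtension x L r U with hf
  have hfs := h.contMDiff_boundaryLayer χ hχ hσ hε (β := β)
  have hUsupp : ∀ y ∉ closedBall (L (extChartAt (𝓡∂ n) x x)) χ.rOut, U y = 0 := fun y hy ↦ by
    rw [hU, boundaryLayer, χ.zero_of_le_dist (le_of_lt (by simpa using hy)), zero_mul]
  obtain ⟨hint, heq⟩ := energy_eq_integral_sub
    (energyConverges_ofSmooth hn hS hK hH hfs)
  rw [heq]
  refine sub_le_sub_right ?_ _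
  set D : M → ℝ := fun y ↦ 2 * ((n : ℝ) - 1) / ((n : ℝ) - 2) * ‖riemGradient (n := n) f y‖ ^ 2 +
      1 / 2 * (S y * f y ^ 2) +
        1 / criticalExponent n * (-K y * |f y| ^ criticalExponent n) with hD
  change ∫ y, D y ∂(riemVolume n M) ≤ _
  have hDint : Integrable D (riemVolume n M) := hint
  have hDV : ∀ y, D y - C₂ ≤ (chartBall x L r).indicator
      (fun y ↦ κ * (σ * (L (extChartAt (𝓡∂ n) x y) 0 + ε)) ^ (-(n : ℝ))) y := by
    intro y
    have hKP : 0 ≤ 1 / criticalExponent n * K₀ := by positivity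
    by_cases hy : y ∈ chartBall x L r
    · rw [indicator_of_mem hy]
      have hy0 := h.apply_zero_nonneg y
      have hfy : f y = 1 + U (L (extChartAt (𝓡∂ n) x y)) := chartExtension_of_mem hy
      have hz : 0 < σ * (L (extChartAt (𝓡∂ n) x y) 0 + ε) := by positivity
      have hgrad := h.norm_riemGradient_chartExtension_le (U := U)
        (fun y hy ↦ contDiffAt_boundaryLayer χ.contDiff hσ hε hy) hy
      have hfd := norm_fderiv_boundaryLayer_le (β := β) (ε := ε) χ.contDiff χ.nonneg χ.le_one
        (hC₀ (L (extChartAt (𝓡∂ n) x y))) hσ hβ0 hε hy0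
      have := hdens (σ * (L (extChartAt (𝓡∂ n) x y) 0 + ε)) (U (L (extChartAt (𝓡∂ n) x y)))
        ‖riemGradient (n := n) f y‖ (-K y) (S y) hz
        (mul_nonneg χ.nonneg (Real.rpow_nonneg hz.le _))
        (mul_le_of_le_one_left (Real.rpow_nonneg hz.le _) χ.le_one) (norm_nonneg _)
        (hgrad.trans (by gcongr)) ((le_abs_self _).trans (hSb y)) (by linarith [hK0 y])
        (hKV y hy)
      rw [← hfy] at this
      have hDy : D y ≤ κ * (σ * (L (extChartAt (𝓡∂ n) x y) 0 + ε)) ^ (-(n : ℝ)) + C₁ := this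
      linarith
    · rw [indicator_of_notMem hy]
      have hfy : f y = 1 := chartExtension_of_notMem hy
      have hg : riemGradient (n := n) f y = 0 :=
        h.riemGradient_chartExtension_of_notMem hχ hUsupp hy
      have hDy : D y = 1 / 2 * S y + 1 / criticalExponent n * (-K y) := by
        simp only [hD, hfy, hg]; simp
      have h1 : 1 / criticalExponent n * (-K y) ≤ 1 / criticalExponent n * K₀ := by
        gcongr; exact (neg_le_abs _).trans (hKb y)
      have h2 := (le_abs_self _).trans (hSb y)
      rw [hDy]
      linarith
  have hmeas : Measurable fun s : ℝ ↦ ENNReal.ofReal ((σ * (s + ε)) ^ (-(n : ℝ))) := by fun_prop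
  have hσε : 0 < σ * ε := by positivity
  have hn1 : (0 : ℝ) < n - 1 := by linarith
  have hlint : ∫⁻ y, ENNReal.ofReal (D y - C₂) ∂(riemVolume n M) ≤
      ENNReal.ofReal (κ * ((lam : ℝ) ^ n * v *
        ((σ * ε) ^ (1 - (n : ℝ)) / (σ * (n - 1))))) := by
    calc ∫⁻ y, ENNReal.ofReal (D y - C₂) ∂(riemVolume n M)
        ≤ ∫⁻ y, (chartBall x L r).indicator (fun y ↦ ENNReal.ofReal κ * ENNReal.ofReal
            ((σ * (L (extChartAt (𝓡∂ n) x y) 0 + ε)) ^ (-(n : ℝ)))) y ∂(riemVolume n M) := by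
          refine lintegral_mono fun y ↦ ?_
          refine (ENNReal.ofReal_le_ofReal (hDV y)).trans ?_
          by_cases hy : y ∈ chartBall x L r
          · rw [indicator_of_mem hy, indicator_of_mem hy, ENNReal.ofReal_mul hκ0]
          · rw [indicator_of_notMem hy, indicator_of_notMem hy, ENNReal.ofReal_zero]
      _ = ENNReal.ofReal κ * ∫⁻ y in chartBall x L r, ENNReal.ofReal
            ((σ * (L (extChartAt (𝓡∂ n) x y) 0 + ε)) ^ (-(n : ℝ))) ∂(riemVolume n M) := by
          rw [lintegral_indicator (isOpen_chartBall x L r).measurableSet,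
            lintegral_const_mul' _ _ ENNReal.ofReal_ne_top]
      _ ≤ ENNReal.ofReal κ * (ENNReal.ofReal ((lam : ℝ) ^ n * v) *
            ENNReal.ofReal ((σ * ε) ^ (1 - (n : ℝ)) / (σ * (n - 1)))) := by
          rw [← lintegral_Ici_rpow_neg hσ hε (by linarith : (1 : ℝ) < n)]
          gcongr
          exact hvol _ hmeas
      _ = _ := by
          rw [ENNReal.ofReal_mul hκ0, ENNReal.ofReal_mul (p := (lam : ℝ) ^ n * v) (by positivity)]
  have hb := integral_le_of_lintegral_ofReal_le (hDint.sub (integrable_const C₂))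
    (by positivity) hlint
  have hs : ∫ y, (D y - C₂) ∂(riemVolume n M) =
      ∫ y, D y ∂(riemVolume n M) - C₂ * (riemVolume n M).real univ := by
    rw [integral_sub hDint (integrable_const C₂), integral_const, smul_eq_mul, mul_comm]
  -- The one-dimensional integral cancels n - 1 and one σ, leaving the coefficient (n - 2)σ to be
  -- compared with (n - 2)H.
  have hfinal : κ * ((lam : ℝ) ^ n * v * ((σ * ε) ^ (1 - (n : ℝ)) / (σ * (n - 1)))) =
      (lam : ℝ) ^ (n + 4) * ((n - 2) * σ) * v * (σ * ε) ^ (1 - (n : ℝ)) := by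
    rw [hκ]; field_simp; ring
  have hb' : ∫ y, (D y - C₂) ∂(riemVolume n M) ≤ _ := hb
  rw [hs, hfinal] at hb'
  linarith

/-- The boundary part of the energy of the concentrating functions. -/
theorem IsNearIsometricChart.exists_le_integral_trace (h : IsNearIsometricChart x L lam r)
    (hn : 3 ≤ n) (hlam : 1 < lam) {H : (𝓡∂ n).boundary M → ℝ} (hH : Continuous H)
    {σ η v s : ℝ} (hσ : 0 < σ) (hη : 0 < η) (hs : 1 ≤ s)
    (hHV : ∀ y : (𝓡∂ n).boundary M, (y : M) ∈ chartBall x L r → η ≤ H y)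
    (hvol : ENNReal.ofReal v ≤ ENNReal.ofReal (((lam : ℝ) * s) ^ (n - 1)) *
        surfaceMeasure n M (Subtype.val ⁻¹' chartBall x L (r / s)))
    (χ : ContDiffBump (L (extChartAt (𝓡∂ n) x x))) (hχ : χ.rOut < r) (hχs : r / s ≤ χ.rIn) :
    ∃ C : ℝ, ∀ ε : ℝ, 0 < ε → η * (v / ((lam : ℝ) * s) ^ (n - 1)) * (σ * ε) ^ (1 - (n : ℝ)) - C ≤
        ∫ y, H y * |chartExtension x L r (boundaryLayer χ σ (((n : ℝ) - 2) / 2) ε) y| ^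
          criticalTraceExponent n ∂(surfaceMeasure n M) := by
  have hn' : (3 : ℝ) ≤ n := by exact_mod_cast hn
  have hfin := isFiniteMeasure_surfaceMeasure (n := n) (M := M)
  have hcomp := compactSpace_boundary (n := n) (M := M)
  obtain ⟨H₀, hH₀, hHb⟩ := exists_abs_le_of_compactSpace hH
  set W : Set ((𝓡∂ n).boundary M) := Subtype.val ⁻¹' chartBall x L (r / s) with hW
  have hWm : MeasurableSet W :=
    ((isOpen_chartBall x L (r / s)).preimage continuous_subtype_val).measurableSet
  have hP0 := criticalTraceExponent_nonneg hn
  have hls : (0 : ℝ) < ((lam : ℝ) * s) ^ (n - 1) := by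
    have : (0 : ℝ) < lam := by exact_mod_cast zero_lt_one.trans hlam
    positivity
  have hvW : v / ((lam : ℝ) * s) ^ (n - 1) ≤ (surfaceMeasure n M).real W := by
    rw [div_le_iff₀ hls]
    have hne : ENNReal.ofReal (((lam : ℝ) * s) ^ (n - 1)) * surfaceMeasure n M W ≠ ⊤ :=
      ENNReal.mul_ne_top ENNReal.ofReal_ne_top (measure_ne_top _ _)
    have := (ENNReal.ofReal_le_iff_le_toReal hne).1 hvol
    rwa [ENNReal.toReal_mul, ENNReal.toReal_ofReal hls.le, mul_comm] at this
  refine ⟨H₀ * (surfaceMeasure n M).real univ, fun ε hε ↦ ?_⟩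
  set β := ((n : ℝ) - 2) / 2 with hβ
  set f := chartExtension x L r (boundaryLayer χ σ β ε) with hf
  set Λ := (σ * ε) ^ (1 - (n : ℝ)) with hΛ
  have hσε : 0 < σ * ε := by positivity
  have hΛ0 : 0 < Λ := by positivity
  have hfc : Continuous (fun y : (𝓡∂ n).boundary M ↦ f y) :=
    (h.contMDiff_boundaryLayer χ hχ hσ hε (β := β)).continuous.comp continuous_subtype_val
  have hint : Integrable (fun y ↦ H y * |f y| ^ criticalTraceExponent n) (surfaceMeasure n M) :=
    (continuous_mul_abs_rpow hH hfc hP0).integrable_of_hasCompactSupport (.of_compactSpace _)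
  -- On the smaller ball the cutoff is 1 and the normal coordinate 0; on the rest of the chart the
  -- integrand is nonnegative since H ≥ η > 0; off the chart it is H.
  have hlow : ∀ y : (𝓡∂ n).boundary M,
      W.indicator (fun _ ↦ η * Λ) y - H₀ ≤ H y * |f y| ^ criticalTraceExponent n := by
    intro y
    by_cases hyV : (y : M) ∈ chartBall x L r
    · have hHy := hHV y hyV
      by_cases hyW : y ∈ W
      · rw [indicator_of_mem hyW]
        have hy0 := (h.mem_boundary_iff hyV.1).1 y.2
        have hχ1 : χ (L (extChartAt (𝓡∂ n) x y)) = 1 :=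
          χ.one_of_mem_closedBall (ball_subset_closedBall (ball_subset_ball hχs hyW.2))
        have hfy : f y = 1 + (σ * ε) ^ (-β) := by
          rw [hf, chartExtension_of_mem hyV, boundaryLayer, hχ1, hy0, zero_add, one_mul]
        have hw0 : 0 ≤ (σ * ε) ^ (-β) := by positivity
        have hwP : ((σ * ε) ^ (-β)) ^ criticalTraceExponent n = Λ := by
          rw [← Real.rpow_mul hσε.le, hΛ]
          congr 1
          have : (n : ℝ) - 2 ≠ 0 := by linarith
          rw [hβ, criticalTraceExponent]
          field_simp
          ring
        have h1 : Λ ≤ |f y| ^ criticalTraceExponent n := by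
          rw [← hwP]
          refine Real.rpow_le_rpow hw0 ?_ hP0
          rw [hfy, abs_of_nonneg (by positivity)]
          linarith
        have h2 : η * Λ ≤ H y * |f y| ^ criticalTraceExponent n :=
          mul_le_mul hHy h1 hΛ0.le (hη.le.trans hHy)
        linarith
      · rw [indicator_of_notMem hyW]
        have : 0 ≤ H y * |f y| ^ criticalTraceExponent n :=
          mul_nonneg (hη.le.trans hHy) (Real.rpow_nonneg (abs_nonneg _) _)
        linarith
    · have hyW : y ∉ W := fun hyW ↦ hyV (chartBall_mono x L (div_le_self h.r_pos.le hs) hyW)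
      have hfy : f y = 1 := chartExtension_of_notMem hyV
      rw [indicator_of_notMem hyW, hfy]
      have := (neg_le_abs (H y)).trans (hHb y)
      simp only [abs_one, Real.one_rpow]
      linarith
  have hind : Integrable (W.indicator fun _ ↦ η * Λ) (surfaceMeasure n M) :=
    (integrable_const _).indicator hWm
  have hmono := integral_mono (hind.sub (integrable_const H₀)) hint hlow
  have hcalc : ∫ y, (W.indicator (fun _ ↦ η * Λ) y - H₀) ∂(surfaceMeasure n M) =
      (surfaceMeasure n M).real W * (η * Λ) - H₀ * (surfaceMeasure n M).real univ := by
    rw [integral_sub hind (integrable_const H₀), integral_indicator_const _ hWm, integral_const,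
      smul_eq_mul, smul_eq_mul, mul_comm H₀]
  have hmono' : ∫ y, (W.indicator (fun _ ↦ η * Λ) y - H₀) ∂(surfaceMeasure n M) ≤ _ := hmono
  rw [hcalc] at hmono'
  have : v / ((lam : ℝ) * s) ^ (n - 1) * (η * Λ) ≤ (surfaceMeasure n M).real W * (η * Λ) :=
    mul_le_mul_of_nonneg_right hvW (by positivity)
  linarith

end ConcentratingEnergy

/-! ### Choice of constants and conclusion. -/

section Main

open scoped NNReal

theorem exists_one_lt_mul_pow_lt {a b : ℝ} (hab : a < b) (N : ℕ) :
    ∃ lam : ℝ≥0, 1 < lam ∧ (lam : ℝ) ^ N * a < b := by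
  have hlim : Tendsto (fun t : ℝ ↦ t ^ N * a) (𝓝[>] 1) (𝓝 (1 ^ N * a)) :=
    Tendsto.mono_left (Continuous.tendsto (by fun_prop) 1) nhdsWithin_le_nhds
  obtain ⟨t, ht, ht1⟩ := ((hlim.eventually_lt_const (u := b) (by simpa using hab)).and
    self_mem_nhdsWithin).exists
  have ht1' : 1 < t := ht1
  exact ⟨⟨t, by linarith⟩, by exact_mod_cast ht1', ht⟩

end Main

theorem mainTheorem10 (n : ℕ) [NeZero n] (hn : 3 ≤ n)
    (M : Type*) [EMetricSpace M] [CompactSpace M] [MeasurableSpace M] [BorelSpace M]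
    [ChartedSpace (EuclideanHalfSpace n) M] [IsManifold (𝓡∂ n) ∞ M]
    [RiemannianBundle (fun x : M ↦ TangentSpace (𝓡∂ n) x)]
    [IsContMDiffRiemannianBundle (𝓡∂ n) ∞ (EuclideanSpace ℝ (Fin n))
      (fun x : M ↦ TangentSpace (𝓡∂ n) x)]
    [IsRiemannianManifold (𝓡∂ n) M]
    (S K : M → ℝ) (hS : Continuous S) (hK : Continuous K) (hKneg : ∀ x, K x < 0)
    (H : (𝓡∂ n).boundary M → ℝ) (hH : Continuous H)
    (hD : ∃ p : (𝓡∂ n).boundary M, 1 < scalingInvariant K H p) :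
    ∃ φ : ℕ → SobolevH1 n M,
      (∀ k x, 0 < (φ k).toFun x) ∧
      (∀ k, EnergyConverges S K H (φ k)) ∧
      Tendsto (fun k ↦ energy S K H (φ k)) atTop atBot := by
  have hcont : IsContinuousRiemannianBundle (EuclideanSpace ℝ (Fin n))
      (fun x : M ↦ TangentSpace (𝓡∂ n) x) := by
    obtain ⟨g, hg, hgi⟩ := IsContMDiffRiemannianBundle.exists_contMDiff (IB := 𝓡∂ n) (n := ∞)
      (F := EuclideanSpace ℝ (Fin n)) (E := fun x : M ↦ TangentSpace (𝓡∂ n) x)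
    exact ⟨g, hg.continuous, hgi⟩
  obtain ⟨p, hp⟩ := hD
  have hn' : (3 : ℝ) ≤ n := by exact_mod_cast hn
  have hnn : (0 : ℝ) < n * (n - 1) := mul_pos (by linarith) (by linarith)
  have ha : 0 < -K p := by linarith [hKneg p]
  -- With this σ the scaling invariant at `p` is H(p)/σ.
  set σ := √(-K p) / √((n : ℝ) * (n - 1)) with hσdef
  have hσ : 0 < σ := by positivity
  have hσ2 : σ ^ 2 * (n * (n - 1)) = -K p := by
    rw [hσdef, div_pow, Real.sq_sqrt ha.le, Real.sq_sqrt hnn.le, div_mul_cancel₀ _ hnn.ne']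
  have hσH : σ < H p := by
    rw [scalingInvariant, abs_of_neg (hKneg p), mul_div_assoc',
      one_lt_div (Real.sqrt_pos.2 ha)] at hp
    rw [hσdef, div_lt_iff₀ (Real.sqrt_pos.2 hnn), mul_comm]
    exact hp
  have hHp : 0 < H p := hσ.trans hσH
  -- The losses: n + 4 from the interior bound, 1 from H ≥ H(p)/`lam` near `p`, n - 1 from comparing
  -- areas, and n - 1 from shrinking the radius to r/`lam`.
  obtain ⟨lam, hlam, hlamH⟩ := exists_one_lt_mul_pow_lt hσH (n + 4 + 1 + 2 * (n - 1))
  have hlam' : (1 : ℝ) < lam := by exact_mod_cast hlam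
  have hlam0 : (0 : ℝ) < lam := by linarith
  have hN1 : {y : M | -K y < lam * -K p} ∈ 𝓝 (p : M) :=
    (hK.neg.isOpen_preimage _ isOpen_Iio).mem_nhds (by
      show -K p < lam * -K p
      nlinarith)
  have hN2 : {y : (𝓡∂ n).boundary M | H p / lam < H y} ∈ 𝓝 p :=
    (hH.isOpen_preimage _ isOpen_Ioi).mem_nhds (div_lt_self hHp hlam')
  obtain ⟨N2, hN2p, hN2s⟩ := mem_nhds_induced _ _ _ |>.1 hN2
  obtain ⟨L, r, h, hV⟩ := exists_isNearIsometricChart (n := n) (p : M) (inter_mem hN1 hN2p) hlam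
  obtain ⟨v, hv, hvol, hsurf⟩ := h.exists_volume_bounds p.2
  have hr := h.r_pos
  have hrl : r / lam < r := div_lt_self hr hlam'
  let χ : ContDiffBump (L (extChartAt (𝓡∂ n) (p : M) p)) :=
    ⟨r / lam, (r / lam + r) / 2, by positivity, by linarith⟩
  have hχ : χ.rOut < r := by show (r / lam + r) / 2 < r; linarith
  obtain ⟨C₁, hC₁⟩ := h.exists_integral_energyDensity_le hn hlam hS hK hKneg hH hσ
    (fun y hy ↦ by rw [hσ2]; exact (hV hy).1.le) hv hvol χ hχ
  obtain ⟨C₂, hC₂⟩ := h.exists_le_integral_trace hn hlam hH hσ (div_pos hHp hlam0) hlam'.le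
    (fun y hy ↦ le_of_lt (hN2s (hV hy).2)) (hsurf lam hlam'.le) χ hχ le_rfl
  have hε (k : ℕ) : (0 : ℝ) < 1 / (k + 1) := by positivity
  refine ⟨fun k ↦ SobolevH1.ofSmooth _ (h.contMDiff_boundaryLayer χ hχ hσ (hε k)
    (β := ((n : ℝ) - 2) / 2)), fun k y ↦ ?_, fun k ↦ energyConverges_ofSmooth hn hS hK hH _, ?_⟩
  · show 0 < chartExtension _ _ _ _ y
    by_cases hy : y ∈ chartBall (p : M) L r
    · rw [chartExtension_of_mem hy]
      have h0 := h.apply_zero_nonneg y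
      have h1 := hε k
      have : 0 ≤ boundaryLayer χ σ (((n : ℝ) - 2) / 2) (1 / (k + 1)) (L (extChartAt (𝓡∂ n) (p : M) y)) :=
        mul_nonneg χ.nonneg (Real.rpow_nonneg (by positivity) _)
      linarith
    · rw [chartExtension_of_notMem hy]
      exact one_pos
  -- The net coefficient of -(σε)^(1-n); its positivity is exactly the choice of `lam`.
  set c := ((n : ℝ) - 2) * v * (H p / lam / ((lam : ℝ) * lam) ^ (n - 1) - (lam : ℝ) ^ (n + 4) * σ)
    with hc
  have hc0 : 0 < c := by
    refine mul_pos (mul_pos (by linarith) hv) (sub_pos.2 ?_)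
    rw [div_div, lt_div_iff₀ (by positivity)]
    refine lt_of_eq_of_lt ?_ hlamH
    rw [← sq, ← pow_mul]
    ring
  have hbound (k : ℕ) : energy S K H (SobolevH1.ofSmooth _ (h.contMDiff_boundaryLayer χ hχ hσ (hε k)
      (β := ((n : ℝ) - 2) / 2))) ≤ C₁ + ((n : ℝ) - 2) * C₂ +
        -(c * (σ * (1 / ((k : ℝ) + 1))) ^ (1 - (n : ℝ))) := by
    have h1 := hC₁ _ (hε k)
    have h2 := mul_le_mul_of_nonneg_left (hC₂ _ (hε k)) (show 0 ≤ (n : ℝ) - 2 by linarith)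
    refine h1.trans ?_
    have h3 : c * (σ * (1 / ((k : ℝ) + 1))) ^ (1 - (n : ℝ)) =
        (n - 2) * (H p / lam * (v / ((lam : ℝ) * lam) ^ (n - 1)) *
          (σ * (1 / ((k : ℝ) + 1))) ^ (1 - (n : ℝ))) -
        (lam : ℝ) ^ (n + 4) * ((n - 2) * σ) * v * (σ * (1 / ((k : ℝ) + 1))) ^ (1 - (n : ℝ)) := by
      rw [hc]; ring
    rw [mul_sub] at h2
    rw [h3]
    linarith
  refine tendsto_atBot_mono hbound (tendsto_atBot_add_const_left _ _ ?_)
  refine tendsto_neg_atTop_atBot.comp (Tendsto.const_mul_atTop hc0 ?_)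
  have h1 : Tendsto (fun k : ℕ ↦ σ⁻¹ * ((k : ℝ) + 1)) atTop atTop :=
    (tendsto_atTop_add_const_right _ 1 tendsto_natCast_atTop_atTop).const_mul_atTop
      (by positivity)
  refine ((tendsto_rpow_atTop (y := (n : ℝ) - 1) (by linarith)).comp h1).congr fun k ↦ ?_
  have h2 : σ⁻¹ * ((k : ℝ) + 1) = (σ * (1 / ((k : ℝ) + 1)))⁻¹ := by
    field_simp
  have h3 : 0 < σ * (1 / ((k : ℝ) + 1)) := mul_pos hσ (hε k)
  rw [Function.comp_apply, h2, Real.inv_rpow h3.le, ← Real.rpow_neg h3.le]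
  congr 1
  ring
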